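/- Throughout, $\mathrm{Act}$ is a set of visible actions and $\tau\notin\mathrm{Act}$. A *Petri net* is a tuple $N=(S,T,F,M_0,\ell)$ with disjoint sets $S$ (places) and $T$ (transitions), $F:(S\times T)\cup(T\times S)\to\mathbb N$, $M_0:S\to\mathbb N$ and $\ell:T\to \mathrm{Act}\cup\{\tau\}$. For $x\in S\cup T$, ${}^\bullet x$ and $x^\bullet$ are the multisets ${}^\bullet x(y)=F(y,x)$, $x^\bullet(y)=F(x,y)$; $\cap,\cup,\subseteq$ of multisets are pointwise $\min,\max,\le$. A finite nonempty multiset $G$ of transitions is a step $M\,[G\rangle\, M'$ iff ${}^\bullet G\le M$ and $M'=M-{}^\bullet G+G^\bullet$, with ${}^\bullet G=\sum_t G(t)\cdot{}^\bullet t$ and $G^\bullet=\sum_t G(t)\cdot t^\bullet$; $M[G\rangle$ means that such an $M'$ exists. $[M_0\rangle$ is the least set of markings containing $M_0$ and closed under steps. Write $t\smile u$ iff $M[\{t\}+\{u\}\rangle$ for some $M\in[M_0\rangle$. The net $N$ is * *plain* if $\ell$ is injective and never $\tau$; * *finitary* if ${}^\bullet t\ne\emptyset$ for all $t\in T$, and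 every reachable marking is finite and enables only finitely many transitions; * a *structural conflict net* if $t\smile u$ implies ${}^\bullet t\cap{}^\bullet u=\emptyset$ (for all $t,u\in T$, including $t=u$). It *has a fully reachable pure M* if there are $t,u,v\in T$ and $M\in[M_0\rangle$ with ${}^\bullet t\cap{}^\bullet u\neq\emptyset$, ${}^\bullet u\cap{}^\bullet v\ne\emptyset$, ${}^\bullet t\cap{}^\bullet v=\emptyset$ and ${}^\bullet t\cup{}^\bullet u\cup{}^\bullet v\subseteq M$. It is *essentially distributed* if there is an equivalence relation $\equiv_D$ on $S\cup T$ (co-location) such that $s\in{}^\bullet t$ implies $t\equiv_D s$, and $t\smile u\wedge\ell(t)\neq\tau$ implies $t\not\equiv_D u$. *Nets with reversible transitions.* Such a net has places, labelled transitions, an initial marking, a set of undo interfaces $\omega$, a set $\Omega_\omega$ of transitions for each of them, arcs of the types *in, early, late, out, far* with weights in $\mathbb N$ (giving multisets of places $t^{in},t^{early},t^{late},t^{out},t^{far}$), and places $\mathsf{undo}_\omega(t),\mathsf{reset}_\omega(t),\mathsf{ack}_\omega(t)$ for each $t\in\Omega_\omega$. A transition is *reversible* if it is in some $\Omega_\omega$;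 other transitions only have *in* and *out* arcs, and these are their ordinary pre- and postplaces. The net stands for the Petri net with the same places and initial marking, and the same non-reversible transitions, plus, for each reversible $t$, each $\omega$ with $t\in\Omega_\omega$ and each $f\in t^{far}$, the following transitions, and the initially unmarked new places $\mathsf{fired}(t),\mathsf{keep}_\omega(t),\mathsf{take}(f,t),\mathsf{took}(f,t),\rho(t)$ mentioned in them: * $t\cdot\mathsf{fire}$, labelled $\ell(t)$: from $t^{in}+t^{early}+t^{late}$ to $\mathsf{fired}(t)+t^{out}+t^{far}$; * $t\cdot\mathsf{undo}_\omega$, labelled $\tau$: from $\mathsf{undo}_\omega(t),\mathsf{fired}(t)$ to $\mathsf{keep}_\omega(t)$ and all $\mathsf{take}(f,t)$, $f\in t^{far}$; * $t\cdot\mathsf{undo}(f)$, labelled $\tau$: from $\mathsf{take}(f,t)$ and $f$ (with weight $t^{far}(f)$) to $\mathsf{took}(f,t)$; * $t\cdot\mathsf{undone}$, labelled $\tau$: from all $\mathsf{took}(f,t)$, $f\in t^{far}$, to $\rho(t)+t^{early}$; * $t\cdot\mathsf{reset}_\omega$, labelled $\tau$: from $\mathsf{reset}_\omega(t),\mathsf{keep}_\omega(t),\rho(t)$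 to $t^{late}+\mathsf{ack}_\omega(t)$; * $t\cdot\mathsf{elide}_\omega$, labelled $\tau$: from $\mathsf{undo}_\omega(t),\mathsf{reset}_\omega(t)$ to $\mathsf{ack}_\omega(t)$. *The conflict replicating implementation.* Let $N=(S,T,F,M_0,\ell)$ be a Petri net, and fix a well-ordering $<$ on $T$. Write $i\# j$ iff $i\neq j$ and ${}^\bullet i\cap{}^\bullet j\neq\emptyset$; $i\stackrel{\#}{=}j$ iff $i\# j$ or $i=j$; $i<^\# j$ iff $i<j$ and $i\# j$; $i\le^\# j$ iff $i<^\# j$ or $i=j$. The conflict replicating implementation $\mathcal I(N)$ is the Petri net denoted by the following net with reversible transitions. Its undo interfaces are the $i\in T$, with $$\Omega_i=\{\mathsf{initialise}_c\mid c\stackrel{\#}{=}i\}\cup\{\mathsf{transfer}^b_c\mid b<^\# c\stackrel{\#}{=}i\}.$$ Its places are those of $S$, marked as in $M_0$; places $\pi_j$ ($j\in T$) and $\pi_{j\#l}$ ($j\le^\# l$), each marked with one token; and the unmarked places $p_c$ ($p\in{}^\bullet c$), $\mathsf{pre}^i_j$ ($i\le^\# j$), $\mathsf{trans}^h_j\textsf{-in}$,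 $\mathsf{trans}^h_j\textsf{-out}$ ($h<^\# j$), $\mathsf{fetch}^{p,c}_{i,j}\textsf{-in}$, $\mathsf{fetch}^{p,c}_{i,j}\textsf{-out}$ ($i\le^\# j$, $p\in{}^\bullet i$, $c\in p^\bullet$), and $\mathsf{undo}_i(t),\mathsf{reset}_i(t),\mathsf{ack}_i(t)$ ($t\in\Omega_i$). Its transitions, with arcs of weight 1 and label $\tau$ unless said otherwise, are: * $\mathsf{distribute}_p$, for $p\in S$ with $p^\bullet\ne\emptyset$: in $p$; out all $p_c$, $c\in p^\bullet$; * $\mathsf{initialise}_j$, for $j\in T$: early all $p_j$, $p\in{}^\bullet j$, with weight $F(p,j)$; late $\pi_j$; far all $\mathsf{pre}^j_k$, $k\geq^\# j$, and all $\mathsf{trans}^h_j\textsf{-in}$, $h<^\# j$; * $\mathsf{transfer}^h_j$, for $h<^\# j$: early $\mathsf{trans}^h_j\textsf{-in}$; late $\pi_{h\#j}$; far $\mathsf{trans}^h_j\textsf{-out}$; * $\mathsf{execute}^i_j$, for $i\le^\# j$, labelled $\ell(i)$: in $\mathsf{pre}^i_j$, all $\mathsf{trans}^h_j\textsf{-out}$,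 $h<^\# j$, and all $\pi_{j\#l}$, $l\ge^\# j$; out $\mathsf{pre}^i_j$, all $\mathsf{trans}^h_j\textsf{-out}$, $h<^\# j$, all $\mathsf{fetch}^{p,c}_{i,j}\textsf{-in}$, $p\in{}^\bullet i$, $c\in p^\bullet$, and all $\mathsf{undo}_i(t)$, $t\in\Omega_i$; * $\mathsf{fetch}^{p,c}_{i,j}$, for $i\le^\# j$, $p\in{}^\bullet i$, $c\in p^\bullet$: in $\mathsf{fetch}^{p,c}_{i,j}\textsf{-in}$ and $p_c$, the latter with weight $F(p,i)$; out $\mathsf{fetch}^{p,c}_{i,j}\textsf{-out}$; * $\mathsf{fetched}^i_j$, for $i\le^\# j$: in all $\mathsf{fetch}^{p,c}_{i,j}\textsf{-out}$, $p\in{}^\bullet i$, $c\in p^\bullet$; out all $\pi_{j\#l}$, $l\ge^\# j$, and all $\mathsf{reset}_i(t)$, $t\in\Omega_i$; * $\mathsf{finalise}^i$, for $i\in T$: in all $\mathsf{ack}_i(t)$, $t\in\Omega_i$; out all $r\in i^\bullet$, with weight $F(i,r)$. **Theorem.** Let $N$ be a finitary plain structural conflict net without a fully reachable pure M. Then, for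 every well-ordering of its transitions, the conflict replicating implementation $\mathcal I(N)$ of $N$ is essentially distributed. -/

import Mathlib

/-- A labelled Petri net (with arc weights) over `Act ∪ {τ}`, with set of places `S` and set of
transitions `T`.  Labels live in `Option Act`, where `none` is the invisible action `τ`. -/
structure PetriNet (Act S T : Type*) where
  /-- `pre t s` is the arc weight `F(s,t)`; thus `pre t` is the multiset of preplaces of `t`. -/
  pre : T → S → ℕ
  /-- `post t s` is the arc weight `F(t,s)`; thus `post t` is the multiset of postplaces of `t`. -/
  post : T → S → ℕ
  /-- the initial marking -/
  M0 : S → ℕ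
  /-- the labelling function -/
  label : T → Option Act

/-- The number 1 if `P` holds, and 0 otherwise. -/
noncomputable def ind (P : Prop) : ℕ :=
  open Classical in if P then 1 else 0

namespace PetriNet

variable {Act S T : Type*} (N : PetriNet Act S T)

/-- `M [G⟩ M'`: the finite nonempty multiset `G` of transitions is a step from `M` to `M'`.
The sums are pointwise sums of multisets of places. -/
def Step (M : S → ℕ) (G : Multiset T) (M' : S → ℕ) : Prop :=
  G ≠ 0 ∧ (G.map N.pre).sum ≤ M ∧ M' = (M - (G.map N.pre).sum) + (G.map N.post).sum

/-- `M [G⟩`: the step `G` is enabled at `M`. -/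
def Enabled (M : S → ℕ) (G : Multiset T) : Prop :=
  ∃ M', N.Step M G M'

/-- The set `[M₀⟩` of reachable markings. -/
inductive Reachable : (S → ℕ) → Prop
  | init : Reachable N.M0
  | step {M : S → ℕ} {G : Multiset T} {M' : S → ℕ} :
      Reachable M → N.Step M G M' → Reachable M'

/-- The concurrency relation `t ⌣ u`. -/
def Concurrent (t u : T) : Prop :=
  ∃ M, N.Reachable M ∧ N.Enabled M ({t} + {u})

/-- Structural conflict nets: concurrent transitions have no common preplaces. -/
def StructuralConflict : Prop :=
  ∀ t u, N.Concurrent t u → N.pre t ⊓ N.pre u = 0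

/-- Plain nets: the labelling is injective and no transition is labelled `τ`. -/
def Plain : Prop :=
  Function.Injective N.label ∧ ∀ t, N.label t ≠ none

/-- Finitary nets: every transition has a preplace, and each reachable marking is finite and
enables only finitely many transitions. -/
def Finitary : Prop :=
  (∀ t, N.pre t ≠ 0) ∧
  ∀ M, N.Reachable M → {s | M s ≠ 0}.Finite ∧ {t | N.Enabled M {t}}.Finite

/-- `N` has a fully reachable pure M.  Intersection, union and inclusion of multisets are
`⊓`, `⊔` and `≤`. -/
def HasFullyReachablePureM : Prop :=
  ∃ t u v : T, N.pre t ⊓ N.pre u ≠ 0 ∧ N.pre u ⊓ N.pre v ≠ 0 ∧ N.pre t ⊓ N.pre v = 0 ∧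
    ∃ M, N.Reachable M ∧ N.pre t ⊔ N.pre u ⊔ N.pre v ≤ M

/-- Essentially distributed nets.  A distribution is represented by its co-location relation, an
equivalence relation on the disjoint union of places and transitions. -/
def EssentiallyDistributed : Prop :=
  ∃ D : Setoid (S ⊕ T),
    (∀ (s : S) (t : T), 0 < N.pre t s → D.r (Sum.inr t) (Sum.inl s)) ∧
    (∀ t u : T, N.Concurrent t u ∧ N.label t ≠ none → ¬ D.r (Sum.inr t) (Sum.inr u))

end PetriNet

/-! ### Petri nets with reversible transitions -/

/-- The five types of arcs of a net with reversible transitions: in, early, late, out, far. -/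
inductive ArcType
  | inn | early | late | out | far

/-- A Petri net with reversible transitions, with places `S`, transitions `T` and undo
interfaces `Ω`. -/
structure ReversibleNet (Act S T Ω : Type*) where
  /-- the relation linking undo interfaces to transitions -/
  ui : Ω → T → Prop
  /-- the flow relation -/
  F : S → T → ArcType → ℕ
  M0 : S → ℕ
  label : T → Option Act
  /-- the place `undo_ω(t)` -/
  undo : ∀ ω t, ui ω t → S
  /-- the place `reset_ω(t)` -/
  reset : ∀ ω t, ui ω t → S
  /-- the place `ack_ω(t)` -/
  ack : ∀ ω t, ui ω t → S
  /-- transitions without undo interfaces only have arcs of types in and out -/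
  standard_arcs : ∀ t, (¬ ∃ ω, ui ω t) → ∀ s,
    F s t ArcType.early = 0 ∧ F s t ArcType.late = 0 ∧ F s t ArcType.far = 0

namespace ReversibleNet

variable {Act S T Ω : Type*} (R : ReversibleNet Act S T Ω)

/-- A transition is reversible if it has an undo interface. -/
def Reversible (t : T) : Prop := ∃ ω, R.ui ω t

/-- The places of the macro expansion. -/
inductive XPlace
  | base (s : S)
  | fired (t : T) (ht : R.Reversible t)
  | keep (ω : Ω) (t : T) (h : R.ui ω t)
  | take (f : S) (t : T) (ht : R.Reversible t) (hf : 0 < R.F f t ArcType.far)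
  | took (f : S) (t : T) (ht : R.Reversible t) (hf : 0 < R.F f t ArcType.far)
  | rho (t : T) (ht : R.Reversible t)

/-- The transitions of the macro expansion: the standard transitions, and
`t·fire`, `t·undo_ω`, `t·undo(f)`, `t·undone`, `t·reset_ω`, `t·elide_ω`. -/
inductive XTrans
  | standard (t : T) (ht : ¬ R.Reversible t)
  | fire (t : T) (ht : R.Reversible t)
  | undoI (ω : Ω) (t : T) (h : R.ui ω t)
  | undoF (f : S) (t : T) (ht : R.Reversible t) (hf : 0 < R.F f t ArcType.far)
  | undone (t : T) (ht : R.Reversible t)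
  | reset (ω : Ω) (t : T) (h : R.ui ω t)
  | elide (ω : Ω) (t : T) (h : R.ui ω t)

/-- A multiset of places of the untranslated net, as multiset of places of its expansion. -/
def lift (A : S → ℕ) : R.XPlace → ℕ
  | .base s => A s
  | _ => 0

/-- The multisets of preplaces in the expansion. -/
noncomputable def xpre : R.XTrans → R.XPlace → ℕ
  | .standard t _, x => R.lift (fun s => R.F s t .inn) x
  | .fire t _, x => R.lift (fun s => R.F s t .inn + R.F s t .early + R.F s t .late) x
  | .undoI ω t h, x => ind (x = .base (R.undo ω t h)) + ind (x = .fired t ⟨ω, h⟩)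
  | .undoF f t ht hf, x => ind (x = .take f t ht hf) + R.F f t .far * ind (x = .base f)
  | .undone t ht, x => ind (∃ f hf, x = .took f t ht hf)
  | .reset ω t h, x =>
      ind (x = .base (R.reset ω t h)) + ind (x = .keep ω t h) + ind (x = .rho t ⟨ω, h⟩)
  | .elide ω t h, x => ind (x = .base (R.undo ω t h)) + ind (x = .base (R.reset ω t h))

/-- The multisets of postplaces in the expansion. -/
noncomputable def xpost : R.XTrans → R.XPlace → ℕ
  | .standard t _, x => R.lift (fun s => R.F s t .out) x
  | .fire t ht, x =>
      ind (x = .fired t ht) + R.lift (fun s => R.F s t .out + R.F s t .far) x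
  | .undoI ω t h, x => ind (x = .keep ω t h) + ind (∃ f hf, x = .take f t ⟨ω, h⟩ hf)
  | .undoF f t ht hf, x => ind (x = .took f t ht hf)
  | .undone t ht, x => ind (x = .rho t ht) + R.lift (fun s => R.F s t .early) x
  | .reset ω t h, x =>
      R.lift (fun s => R.F s t .late) x + ind (x = .base (R.ack ω t h))
  | .elide ω t h, x => ind (x = .base (R.ack ω t h))

/-- The labelling of the expansion. -/
def xlabel : R.XTrans → Option Act
  | .standard t _ => R.label t
  | .fire t _ => R.label t
  | _ => none

/-- The ordinary Petri net into which a net with reversible transitions translates. -/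
noncomputable def expand : PetriNet Act R.XPlace R.XTrans where
  pre := R.xpre
  post := R.xpost
  M0 := R.lift R.M0
  label := R.xlabel

end ReversibleNet

/-! ### The conflict replicating implementation -/

namespace PetriNet

variable {Act S T : Type*} (N : PetriNet Act S T)

/-- `i # j`: distinct transitions with a common preplace. -/
def Conflict (i j : T) : Prop := i ≠ j ∧ N.pre i ⊓ N.pre j ≠ 0

/-- `i # j` or `i = j`. -/
def ConflictEq (i j : T) : Prop := N.Conflict i j ∨ i = j

variable [LinearOrder T]

/-- `i <# j`. -/
def LtC (i j : T) : Prop := i < j ∧ N.Conflict i j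

/-- `i ≤# j`. -/
def LeC (i j : T) : Prop := N.LtC i j ∨ i = j

/-- The transitions of the conflict replicating implementation (before macro expansion). -/
inductive CTrans
  | distribute (p : S) (hp : ∃ j, 0 < N.pre j p)
  | initialise (j : T)
  | transfer (h j : T) (hj : N.LtC h j)
  | execute (i j : T) (hij : N.LeC i j)
  | fetch (p : S) (c i j : T) (hij : N.LeC i j) (hp : 0 < N.pre i p) (hc : 0 < N.pre c p)
  | fetched (i j : T) (hij : N.LeC i j)
  | finalise (i : T)

/-- The set `Ω_i` of transitions that have undo interface `i`. -/
def undoSet (i : T) : Set N.CTrans :=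
  {t | (∃ c, N.ConflictEq c i ∧ t = .initialise c) ∨
    (∃ b c, ∃ h : N.LtC b c, N.ConflictEq c i ∧ t = .transfer b c h)}

/-- The places of the conflict replicating implementation (before macro expansion).
`copy p c` is `p_c`, `piInit j` is `π_j`, `piConf h j` is `π_{h#j}` (also present
for `h = j`), and `pre i j` is `pre^i_j`. -/
inductive CPlace
  | base (s : S)
  | copy (p : S) (c : T) (hc : 0 < N.pre c p)
  | piInit (j : T)
  | piConf (h j : T) (hj : N.LeC h j)
  | pre (i j : T) (hij : N.LeC i j)
  | transIn (h j : T) (hj : N.LtC h j)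
  | transOut (h j : T) (hj : N.LtC h j)
  | fetchIn (p : S) (c i j : T) (hij : N.LeC i j) (hp : 0 < N.pre i p) (hc : 0 < N.pre c p)
  | fetchOut (p : S) (c i j : T) (hij : N.LeC i j) (hp : 0 < N.pre i p) (hc : 0 < N.pre c p)
  | undo (i : T) (t : N.CTrans) (ht : t ∈ N.undoSet i)
  | reset (i : T) (t : N.CTrans) (ht : t ∈ N.undoSet i)
  | ack (i : T) (t : N.CTrans) (ht : t ∈ N.undoSet i)

/-- The typed arcs of the conflict replicating implementation. -/
noncomputable def cFlow (s : N.CPlace) : N.CTrans → ArcType → ℕ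
  | .distribute p _, .inn => ind (s = .base p)
  | .distribute p _, .out => ind (∃ c hc, s = .copy p c hc)
  | .initialise j, .early => match s with
      | .copy p c _ => N.pre j p * ind (c = j)
      | _ => 0
  | .initialise j, .late => ind (s = .piInit j)
  | .initialise j, .far =>
      ind ((∃ k hk, s = .pre j k hk) ∨ (∃ h hj, s = .transIn h j hj))
  | .transfer h j hj, .early => ind (s = .transIn h j hj)
  | .transfer h j hj, .late => ind (s = .piConf h j (Or.inl hj))
  | .transfer h j hj, .far => ind (s = .transOut h j hj)
  | .execute i j hij, .inn =>
      ind (s = .pre i j hij ∨ (∃ h hj, s = .transOut h j hj) ∨ (∃ l hl, s = .piConf j l hl))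
  | .execute i j hij, .out =>
      ind (s = .pre i j hij ∨ (∃ h hj, s = .transOut h j hj) ∨
        (∃ p c hp hc, s = .fetchIn p c i j hij hp hc) ∨ (∃ t ht, s = .undo i t ht))
  | .fetch p c i j hij hp hc, .inn =>
      ind (s = .fetchIn p c i j hij hp hc) + N.pre i p * ind (s = .copy p c hc)
  | .fetch p c i j hij hp hc, .out => ind (s = .fetchOut p c i j hij hp hc)
  | .fetched i j hij, .inn => ind (∃ p c hp hc, s = .fetchOut p c i j hij hp hc)
  | .fetched i j _, .out =>
      ind ((∃ l hl, s = .piConf j l hl) ∨ (∃ t ht, s = .reset i t ht))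
  | .finalise i, .inn => ind (∃ t ht, s = .ack i t ht)
  | .finalise i, .out => match s with
      | .base r => N.post i r
      | _ => 0
  | _, _ => 0

/-- The labelling of the conflict replicating implementation. -/
def cLabel : N.CTrans → Option Act
  | .execute i _ _ => N.label i
  | _ => none

/-- The initial marking of the conflict replicating implementation. -/
def cM0 : N.CPlace → ℕ
  | .base s => N.M0 s
  | .piInit _ => 1
  | .piConf _ _ _ => 1
  | _ => 0

/-- The conflict replicating implementation as a net with reversible transitions; its undo
interfaces are the transitions of `N`. -/
noncomputable def conflictReplicatingRev : ReversibleNet Act N.CPlace N.CTrans T where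
  ui i t := t ∈ N.undoSet i
  F := N.cFlow
  M0 := N.cM0
  label := N.cLabel
  undo := .undo
  reset := .reset
  ack := .ack
  standard_arcs := by
    intro t ht s
    cases t with
    | initialise j => exact absurd ⟨j, Or.inl ⟨j, Or.inr rfl, rfl⟩⟩ ht
    | transfer h j hj => exact absurd ⟨j, Or.inr ⟨h, j, hj, Or.inr rfl, rfl⟩⟩ ht
    | _ => exact ⟨rfl, rfl, rfl⟩

/-- The conflict replicating implementation as an ordinary Petri net, with the macros for
reversible transitions expanded. -/
noncomputable def conflictReplicating :
    PetriNet Act N.conflictReplicatingRev.XPlace N.conflictReplicatingRev.XTrans :=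
  N.conflictReplicatingRev.expand

end PetriNet

/-!
In the implementation the visible transitions are the `execute^i_j`. Each of them is placed at the
location `j`, together with its preplaces and everything that consumes from these; all other places
and transitions, none of which is visible, share one further location. It remains to see that an
enabled `execute^i_j` is concurrent with nothing else at `j`.

The proof keeps the multiset `G` of the transitions fired so far and reads off, for each place, a
balance between its tokens and numbers of occurrences in `G`. An execution `(i, j)` is *in progress*
between `execute^i_j` and `fetched^i_j`; afterwards `i` is *waiting* until `finalise^i`. If each
firing of `i` in the original net `N` is accounted for only at `finalise^i`, a reachable marking of
the implementation simulates a marking `C` of `N`. The balance of the copies `p_c` shows that the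
tokens held by an initialised `c` and those of all waiting `i` are disjoint parts of `C`
(`PetriNet.pre_mul_add_sum_waiting_le`). As `N` is a structural conflict net, a waiting `i` and an
initialised `c` never have a common preplace
(`PetriNet.not_clash_of_waiting_of_initialised`); here is also where stale undo tokens left behind by
an execution are seen to be harmless.

The invariant `PetriNet.Invariant` says that `C` is reachable, that the transitions `i` and `j` of an
execution `(i, j)` in progress are enabled at `C`, that they have no preplace in common with a waiting
transition, and that `(i, j)` blocks all `π_{h#j}`. Without fully reachable pure M, having a common
preplace is transitive among the transitions enabled at `C`; the places `π_{h#j}` then ensure that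
each such cluster has at most one execution in progress, which is what makes the invariant inductive.

The only concurrency at `j` not excluded by a shared place with at most one token is that of
`execute^i_j` with the undoing of a part of some `initialise_g`, where `g` and `j` have a common
preplace. Such an undoing was caused by an execution of some `k` that has a common preplace with `g`,
and which is in progress or waiting. The latter is impossible, as `g` is initialised; the former
contradicts mutual exclusion in the cluster (`PetriNet.Invariant.not_take_of_execute`).
-/

/-! ### Firing histories -/

namespace PetriNet

variable {Act S T : Type*} (N : PetriNet Act S T)

/-- Steps can be sequentialised: a property of a marking together with the multiset of transitions
fired so far holds at every reachable marking, for some history, if it holds initially and is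
preserved by firing single transitions. -/
theorem Reachable.exists_history {N : PetriNet Act S T} {P : (S → ℕ) → Multiset T → Prop}
    (init : P N.M0 0)
    (fire : ∀ M G t, P M G → N.pre t ≤ M → P (M - N.pre t + N.post t) (t ::ₘ G))
    {M : S → ℕ} (hM : N.Reachable M) : ∃ G, P M G := by
  induction hM with
  | init => exact ⟨0, init⟩
  | @step M U M' _ hstep ih =>
    obtain ⟨G, hG⟩ := ih
    obtain ⟨-, hle, rfl⟩ := hstep
    clear * - fire hG hle
    induction U using Multiset.induction_on generalizing M G with
    | empty => exact ⟨G, by simpa using hG⟩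
    | cons t U ihU =>
      simp only [Multiset.map_cons, Multiset.sum_cons] at hle ⊢
      obtain ⟨G', hG'⟩ := ihU (t ::ₘ G)
        (fire M G t hG (le_trans (le_add_of_nonneg_right (fun _ => Nat.zero_le _)) hle))
        (fun s => by
          have := hle s
          simp only [Pi.add_apply, Pi.sub_apply] at this ⊢
          omega)
      refine ⟨G', ?_⟩
      convert hG' using 1
      funext s
      have := hle s
      simp only [Pi.add_apply, Pi.sub_apply] at this ⊢
      omega

/-- The marking equation: `M` results from the initial marking by firing the transitions in `G`. -/
def Balanced (M : S → ℕ) (G : Multiset T) : Prop :=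
  ∀ x, M x + (G.map fun t => N.pre t x).sum = N.M0 x + (G.map fun t => N.post t x).sum

theorem balanced_zero : N.Balanced N.M0 0 := fun x => by simp

variable {N} {M : S → ℕ} {G : Multiset T}

theorem Balanced.cons (hB : N.Balanced M G) {t : T} (ht : N.pre t ≤ M) :
    N.Balanced (M - N.pre t + N.post t) (t ::ₘ G) := fun x => by
  have h1 := hB x
  have h2 : N.pre t x ≤ M x := ht x
  simp only [Multiset.map_cons, Multiset.sum_cons, Pi.add_apply, Pi.sub_apply]
  omega

/-- A place balance follows from the corresponding balance for each transition. -/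
theorem Balanced.of_forall (hB : N.Balanced M G) (x : S) {a b : T → ℕ}
    (h : ∀ t, N.pre t x + a t = N.post t x + b t) :
    M x + (G.map b).sum = N.M0 x + (G.map a).sum := by
  have h1 := hB x
  have h2 : (G.map fun t => N.pre t x + a t).sum = (G.map fun t => N.post t x + b t).sum := by
    simp only [h]
  simp only [Multiset.sum_map_add] at h2
  change _ + (G.map a).sum = _ + (G.map b).sum at h2
  omega

theorem Enabled.pre_add_pre_le {t u : T} (h : N.Enabled M ({t} + {u})) :
    N.pre t + N.pre u ≤ M := by
  obtain ⟨M', -, h, -⟩ := h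
  simpa using h

theorem enabled_pair {t u : T} (h : N.pre t + N.pre u ≤ M) : N.Enabled M ({t} + {u}) :=
  ⟨_, by simp, by simpa using h, rfl⟩

end PetriNet

theorem ind_congr {P Q : Prop} (h : P ↔ Q) : ind P = ind Q := by rw [propext h]

@[simp] theorem ind_true : ind True = 1 := if_pos trivial

@[simp] theorem ind_false : ind False = 0 := if_neg not_false

theorem ind_eq_zero {P : Prop} (h : ¬ P) : ind P = 0 := if_neg h

theorem ind_pos_iff {P : Prop} : 0 < ind P ↔ P := by
  by_cases hP : P <;> simp [hP]

theorem ind_pos {P : Prop} (h : P) : 0 < ind P := ind_pos_iff.2 h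

section Multisets

variable {α β : Type*}

theorem Multiset.count_filterMap_eq_sum [DecidableEq β] (φ : α → Option β) (G : Multiset α)
    (b : β) : (G.filterMap φ).count b = (G.map fun t => ind (φ t = some b)).sum := by
  induction G using Multiset.induction_on with
  | empty => simp
  | cons t G ih =>
    cases h : φ t with
    | none => simp [Multiset.filterMap_cons_none _ _ h, h, ih, ind]
    | some c =>
      simp only [Multiset.filterMap_cons_some _ _ _ h, Multiset.count_cons, ih, h, ind,
        Multiset.map_cons, Multiset.sum_cons, Option.some.injEq, eq_comm (a := b)]
      rw [add_comm]

theorem Multiset.card_filterMap_eq_sum (φ : α → Option β) (G : Multiset α) :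
    (G.filterMap φ).card = (G.map fun t => ind (∃ b, φ t = some b)).sum := by
  induction G using Multiset.induction_on with
  | empty => simp
  | cons t G ih =>
    cases h : φ t with
    | none => simp [Multiset.filterMap_cons_none _ _ h, h, ih, ind]
    | some c => simp [Multiset.filterMap_cons_some _ _ _ h, h, ih, ind, add_comm]

theorem Multiset.sum_map_filterMap (φ : α → Option β) (G : Multiset α) (f : β → ℕ) :
    ((G.filterMap φ).map f).sum = (G.map fun t => (φ t).elim 0 f).sum := by
  induction G using Multiset.induction_on with
  | empty => simp
  | cons t G ih =>
    cases h : φ t with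
    | none => simp [Multiset.filterMap_cons_none _ _ h, h, ih]
    | some c => simp [Multiset.filterMap_cons_some _ _ _ h, h, ih]

theorem Multiset.sum_map_le_of_count_le [DecidableEq α] {A B : Multiset α} {f : α → ℕ}
    (h : ∀ a, 0 < f a → A.count a ≤ B.count a) : (A.map f).sum ≤ (B.map f).sum := by
  have h1 : (A.map f).sum = ((A.filter fun a => 0 < f a).map f).sum := by
    induction A using Multiset.induction_on with
    | empty => simp
    | cons t A ih =>
      have ih := ih fun a ha => (Multiset.count_le_count_cons a t A).trans (h a ha)
      by_cases ht : 0 < f t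
      · simp [ht, ih]
      · simp [ih, Nat.eq_zero_of_not_pos ht]
  rw [h1]
  have h2 : A.filter (fun a => 0 < f a) ≤ B := Multiset.le_iff_count.2 fun a => ?_
  · obtain ⟨C, rfl⟩ := Multiset.le_iff_exists_add.1 h2
    simp
  by_cases ha : 0 < f a
  · rw [Multiset.count_filter_of_pos (p := fun a => 0 < f a) ha]; exact h a ha
  · rw [Multiset.count_filter_of_neg (p := fun a => 0 < f a) ha]; exact Nat.zero_le _

end Multisets

/-! ### Token counts in nets with reversible transitions -/

namespace ReversibleNet

variable {Act S T Ω : Type*} (R : ReversibleNet Act S T Ω)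

/-- Counts `u·fire`. -/
noncomputable def fireOf (u : T) : R.XTrans → ℕ
  | .fire t _ => ind (u = t)
  | _ => 0

/-- Counts `u·undone`. -/
noncomputable def undoneOf (u : T) : R.XTrans → ℕ
  | .undone t _ => ind (u = t)
  | _ => 0

/-- Counts `u·undo(f)`. -/
noncomputable def undoFOf (f : S) (u : T) : R.XTrans → ℕ
  | .undoF g t _ _ => ind (f = g ∧ u = t)
  | _ => 0

open Classical in
/-- The undo interface `ω` of a transition `u·undo_ω`. -/
noncomputable def undoOf (u : T) : R.XTrans → Option Ω
  | .undoI ω t _ => if u = t then some ω else none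
  | _ => none

open Classical in
/-- The undo interface `ω` of a transition `u·reset_ω`. -/
noncomputable def resetOf (u : T) : R.XTrans → Option Ω
  | .reset ω t _ => if u = t then some ω else none
  | _ => none

open Classical in
/-- The undo interface `ω` of a transition `u·elide_ω`. -/
noncomputable def elideOf (u : T) : R.XTrans → Option Ω
  | .elide ω t _ => if u = t then some ω else none
  | _ => none

/-- The number of occurrences of `u·fire` in `G`. -/
noncomputable def fires (u : T) (G : Multiset R.XTrans) : ℕ := (G.map (R.fireOf u)).sum

/-- The number of occurrences of `u·undone` in `G`. -/
noncomputable def undones (u : T) (G : Multiset R.XTrans) : ℕ := (G.map (R.undoneOf u)).sum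

/-- The number of occurrences of `u·undo(f)` in `G`. -/
noncomputable def undoFs (f : S) (u : T) (G : Multiset R.XTrans) : ℕ :=
  (G.map (R.undoFOf f u)).sum

/-- The interfaces of the occurrences of `u·undo_ω` in `G`. -/
noncomputable def undos (u : T) (G : Multiset R.XTrans) : Multiset Ω := G.filterMap (R.undoOf u)

/-- The interfaces of the occurrences of `u·reset_ω` in `G`. -/
noncomputable def resets (u : T) (G : Multiset R.XTrans) : Multiset Ω := G.filterMap (R.resetOf u)

/-- The interfaces of the occurrences of `u·elide_ω` in `G`. -/
noncomputable def elides (u : T) (G : Multiset R.XTrans) : Multiset Ω := G.filterMap (R.elideOf u)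

variable {R} {M : R.XPlace → ℕ} {G : Multiset R.XTrans}

theorem lift_pos_iff {A : S → ℕ} {x : R.XPlace} :
    0 < R.lift A x ↔ ∃ s, x = .base s ∧ 0 < A s := by
  cases x <;> simp [lift]

theorem exists_take_eq_iff {f : S} {t u : T} {ht : R.Reversible t}
    {hf : 0 < R.F f t .far} {hu : R.Reversible u} :
    (∃ g, ∃ hg : 0 < R.F g u .far, XPlace.take f t ht hf = .take g u hu hg) ↔ t = u := by
  constructor
  · rintro ⟨g, hg, e⟩
    injection e
  · rintro rfl
    exact ⟨f, hf, rfl⟩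

theorem exists_took_eq_iff {f : S} {t u : T} {ht : R.Reversible t}
    {hf : 0 < R.F f t .far} {hu : R.Reversible u} :
    (∃ g, ∃ hg : 0 < R.F g u .far, XPlace.took f t ht hf = .took g u hu hg) ↔ t = u := by
  constructor
  · rintro ⟨g, hg, e⟩
    injection e
  · rintro rfl
    exact ⟨f, hf, rfl⟩

theorem fired_balance (hB : R.expand.Balanced M G) (t : T) (ht : R.Reversible t) :
    M (.fired t ht) + (R.undos t G).card = R.fires t G := by
  rw [undos, Multiset.card_filterMap_eq_sum, fires]
  have := hB.of_forall (.fired t ht) (a := R.fireOf t)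
    (b := fun y => ind (∃ b, R.undoOf t y = some b))
    (by
      intro y
      cases y <;> simp [expand, xpre, xpost, lift, fireOf, undoOf]
      exact ind_congr (iff_of_eq (XPlace.fired.injEq ..)))
  simpa [expand, lift] using this

theorem take_balance (hB : R.expand.Balanced M G) (f : S) (t : T) (ht : R.Reversible t)
    (hf : 0 < R.F f t .far) :
    M (.take f t ht hf) + R.undoFs f t G = (R.undos t G).card := by
  rw [undos, Multiset.card_filterMap_eq_sum, undoFs]
  have := hB.of_forall (.take f t ht hf) (b := R.undoFOf f t)
    (a := fun y => ind (∃ b, R.undoOf t y = some b))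
    (by
      intro y
      cases y <;> simp [expand, xpre, xpost, lift, undoFOf, undoOf]
      exact ind_congr exists_take_eq_iff.symm)
  simpa [expand, lift] using this

theorem took_balance (hB : R.expand.Balanced M G) (f : S) (t : T) (ht : R.Reversible t)
    (hf : 0 < R.F f t .far) :
    M (.took f t ht hf) + R.undones t G = R.undoFs f t G := by
  rw [undones, undoFs]
  have := hB.of_forall (.took f t ht hf) (a := R.undoFOf f t) (b := R.undoneOf t)
    (by
      intro y
      cases y with
      | undone u hu =>
        have := exists_took_eq_iff (f := f) (t := t) (ht := ht) (hf := hf) (hu := hu)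
        simp only [expand, xpre, xpost, lift, undoFOf, undoneOf, this]
        simp
      | _ => simp [expand, xpre, xpost, lift, undoFOf, undoneOf])
  simpa [expand, lift] using this

theorem rho_balance (hB : R.expand.Balanced M G) (t : T) (ht : R.Reversible t) :
    M (.rho t ht) + (R.resets t G).card = R.undones t G := by
  rw [resets, Multiset.card_filterMap_eq_sum, undones]
  have := hB.of_forall (.rho t ht) (a := R.undoneOf t)
    (b := fun y => ind (∃ b, R.resetOf t y = some b))
    (by
      intro y
      cases y <;> simp [expand, xpre, xpost, lift, undoneOf, resetOf]
      exact ind_congr (iff_of_eq (XPlace.rho.injEq ..)))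
  simpa [expand, lift] using this

/-- An undo under way was started through some interface: otherwise every `t·undo_ω` would be
matched by a `t·reset_ω`, hence by a `t·undone`. -/
theorem exists_interface_of_take [DecidableEq Ω] (hB : R.expand.Balanced M G) {f : S} {t : T}
    {ht : R.Reversible t} {hf : 0 < R.F f t .far} (hM : 0 < M (.take f t ht hf)) :
    (∃ ω, R.ui ω t ∧ (R.resets t G).count ω < (R.undos t G).count ω) ∧
      R.undones t G < R.fires t G := by
  have h1 := take_balance hB f t ht hf
  have h2 := took_balance hB f t ht hf
  have h3 := rho_balance hB t ht
  have h4 := fired_balance hB t ht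
  refine ⟨?_, by omega⟩
  by_contra hcon
  push Not at hcon
  have hle : R.undos t G ≤ R.resets t G := Multiset.le_iff_count.2 fun ω => by
    by_cases hω : R.ui ω t
    · exact hcon ω hω
    · rw [Multiset.count_eq_zero_of_notMem]
      · exact Nat.zero_le _
      · intro hmem
        obtain ⟨y, -, hy⟩ := (Multiset.mem_filterMap _ _ ).1 hmem
        cases y <;> simp [undoOf] at hy
        obtain ⟨rfl, rfl⟩ := hy
        exact hω (by assumption)
  have := Multiset.card_le_card hle
  omega

end ReversibleNet

/-! ### Token counts in the conflict replicating implementation -/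

namespace PetriNet

open ReversibleNet

variable {Act S T : Type*} [LinearOrder T] {N : PetriNet Act S T}

theorem reversible_initialise (j : T) :
    N.conflictReplicatingRev.Reversible (.initialise j) :=
  ⟨j, Or.inl ⟨j, Or.inr rfl, rfl⟩⟩

theorem reversible_transfer {h j : T} (hj : N.LtC h j) :
    N.conflictReplicatingRev.Reversible (.transfer h j hj) :=
  ⟨j, Or.inr ⟨h, j, hj, Or.inr rfl, rfl⟩⟩

theorem reversible_cases {t : N.CTrans} (ht : N.conflictReplicatingRev.Reversible t) :
    (∃ j, t = .initialise j) ∨ ∃ h j hj, t = .transfer h j hj := by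
  obtain ⟨i, ⟨c, -, rfl⟩ | ⟨b, c, h, -, rfl⟩⟩ := ht
  · exact Or.inl ⟨c, rfl⟩
  · exact Or.inr ⟨b, c, h, rfl⟩

theorem initialise_mem_undoSet_iff {i g : T} :
    CTrans.initialise g ∈ N.undoSet i ↔ N.ConflictEq g i := by
  constructor
  · rintro (⟨c, h, e⟩ | ⟨b, c, hb, h, e⟩) <;> cases e
    exact h
  · exact fun h => Or.inl ⟨g, h, rfl⟩

theorem transfer_mem_undoSet_iff {i h m : T} {hm : N.LtC h m} :
    CTrans.transfer h m hm ∈ N.undoSet i ↔ N.ConflictEq m i := by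
  constructor
  · rintro (⟨c, h, e⟩ | ⟨b, c, hb, h, e⟩) <;> cases e
    exact h
  · exact fun e => Or.inr ⟨h, m, hm, e, rfl⟩

/-- The far arcs, hence the transitions `t·undo(f)`, are of three kinds. -/
theorem far_cases {f : N.CPlace} {t : N.CTrans} (hf : 0 < N.cFlow f t .far) :
    (∃ j k hk, f = .pre j k hk ∧ t = .initialise j) ∨
      (∃ h j hj, f = .transIn h j hj ∧ t = .initialise j) ∨
      (∃ h j hj, f = .transOut h j hj ∧ t = .transfer h j hj) := by
  cases t with
  | initialise j =>
    obtain ⟨k, hk, e⟩ | ⟨h, hj, e⟩ := ind_pos_iff.1 hf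
    · exact Or.inl ⟨j, k, hk, e, rfl⟩
    · exact Or.inr (Or.inl ⟨h, j, hj, e, rfl⟩)
  | transfer h j hj => exact Or.inr (Or.inr ⟨h, j, hj, ind_pos_iff.1 hf, rfl⟩)
  | _ => exact absurd hf (lt_irrefl 0)

theorem cFlow_far_eq_one {f : N.CPlace} {t : N.CTrans} (hf : 0 < N.cFlow f t .far) :
    N.cFlow f t .far = 1 := by
  have hind : ∀ {P}, 0 < ind P → ind P = 1 := fun h => if_pos (ind_pos_iff.1 h)
  cases t <;> first | exact hind hf | exact absurd hf (lt_irrefl 0)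

/-- All far arcs have weight 1, so `t·undo(f)` takes a single token from `f`. -/
theorem pre_undoF (f : N.CPlace) (t : N.CTrans) (ht : N.conflictReplicatingRev.Reversible t)
    (hf : 0 < N.conflictReplicatingRev.F f t .far) (x : N.conflictReplicatingRev.XPlace) :
    N.conflictReplicating.pre (.undoF f t ht hf) x = ind (x = .take f t ht hf) + ind (x = .base f) := by
  change ind _ + N.cFlow f t .far * ind _ = _
  rw [cFlow_far_eq_one hf, one_mul]

/-- The transitions of the expanded net: only the transitions `initialise_j` and `transfer^h_j`
are reversible. -/
@[elab_as_elim]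
theorem xtrans_cases {P : N.conflictReplicatingRev.XTrans → Prop}
    (distribute : ∀ p hp h, P (.standard (.distribute p hp) h))
    (execute : ∀ i j hij h, P (.standard (.execute i j hij) h))
    (fetch : ∀ p c i j hij hp hc h, P (.standard (.fetch p c i j hij hp hc) h))
    (fetched : ∀ i j hij h, P (.standard (.fetched i j hij) h))
    (finalise : ∀ i h, P (.standard (.finalise i) h))
    (fireInitialise : ∀ j ht, P (.fire (.initialise j) ht))
    (fireTransfer : ∀ h j hj ht, P (.fire (.transfer h j hj) ht))
    (undoI : ∀ i t h, P (.undoI i t h))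
    (undoFPre : ∀ j k hk ht hf, P (.undoF (.pre j k hk) (.initialise j) ht hf))
    (undoFTransIn : ∀ h j hj ht hf, P (.undoF (.transIn h j hj) (.initialise j) ht hf))
    (undoFTransOut : ∀ h j hj ht hf, P (.undoF (.transOut h j hj) (.transfer h j hj) ht hf))
    (undoneInitialise : ∀ j ht, P (.undone (.initialise j) ht))
    (undoneTransfer : ∀ h j hj ht, P (.undone (.transfer h j hj) ht))
    (resetInitialise : ∀ i j ht, P (.reset i (.initialise j) ht))
    (resetTransfer : ∀ i h j hj ht, P (.reset i (.transfer h j hj) ht))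
    (elide : ∀ i t h, P (.elide i t h)) (y : N.conflictReplicatingRev.XTrans) : P y := by
  cases y with
  | standard t ht =>
    cases t with
    | distribute => exact distribute ..
    | initialise j => exact absurd (reversible_initialise j) ht
    | transfer h j hj => exact absurd (reversible_transfer hj) ht
    | execute => exact execute ..
    | fetch => exact fetch ..
    | fetched => exact fetched ..
    | finalise => exact finalise ..
  | fire t ht =>
    obtain ⟨j, rfl⟩ | ⟨h, j, hj, rfl⟩ := reversible_cases ht
    · exact fireInitialise ..
    · exact fireTransfer ..
  | undoI => exact undoI ..
  | undoF f t ht hf =>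
    obtain ⟨j, k, hk, rfl, rfl⟩ | ⟨h, j, hj, rfl, rfl⟩ | ⟨h, j, hj, rfl, rfl⟩ := far_cases hf
    · exact undoFPre ..
    · exact undoFTransIn ..
    · exact undoFTransOut ..
  | undone t ht =>
    obtain ⟨j, rfl⟩ | ⟨h, j, hj, rfl⟩ := reversible_cases ht
    · exact undoneInitialise ..
    · exact undoneTransfer ..
  | reset i t ht =>
    obtain ⟨j, rfl⟩ | ⟨h, j, hj, rfl⟩ := reversible_cases ⟨i, ht⟩
    · exact resetInitialise ..
    · exact resetTransfer ..
  | elide => exact elide ..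

/-- The pair `(i, j)` of a transition `execute^i_j`. -/
def execOf : N.conflictReplicatingRev.XTrans → Option (T × T)
  | .standard (.execute i j _) _ => some (i, j)
  | _ => none

/-- The pair `(i, j)` of a transition `fetched^i_j`. -/
def fetchedOf : N.conflictReplicatingRev.XTrans → Option (T × T)
  | .standard (.fetched i j _) _ => some (i, j)
  | _ => none

/-- The index `i` of a transition `finalise^i`. -/
def finOf : N.conflictReplicatingRev.XTrans → Option T
  | .standard (.finalise i) _ => some i
  | _ => none

open Classical in
/-- The pair `(i, j)` of a transition `fetch^{p,c}_{i,j}`. -/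
noncomputable def fetchOf (p : S) (c : T) : N.conflictReplicatingRev.XTrans → Option (T × T)
  | .standard (.fetch q d i j _ _ _) _ => if p = q ∧ c = d then some (i, j) else none
  | _ => none

/-- Counts `distribute_p`. -/
noncomputable def distOf (p : S) : N.conflictReplicatingRev.XTrans → ℕ
  | .standard (.distribute q _) _ => ind (p = q)
  | _ => 0

/-- The pairs `(i, j)` of the occurrences of `execute^i_j` in `G`. -/
def execs (G : Multiset N.conflictReplicatingRev.XTrans) : Multiset (T × T) := G.filterMap execOf

/-- The pairs `(i, j)` of the occurrences of `fetched^i_j` in `G`. -/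
def fetcheds (G : Multiset N.conflictReplicatingRev.XTrans) : Multiset (T × T) :=
  G.filterMap fetchedOf

/-- The indices of the occurrences of `finalise^i` in `G`. -/
def fins (G : Multiset N.conflictReplicatingRev.XTrans) : Multiset T := G.filterMap finOf

/-- The pairs `(i, j)` of the occurrences of `fetch^{p,c}_{i,j}` in `G`. -/
noncomputable def fetches (p : S) (c : T) (G : Multiset N.conflictReplicatingRev.XTrans) :
    Multiset (T × T) := G.filterMap (fetchOf p c)

/-- The number of occurrences of `distribute_p` in `G`. -/
noncomputable def dists (p : S) (G : Multiset N.conflictReplicatingRev.XTrans) : ℕ :=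
  (G.map (distOf p)).sum

theorem count_fst_filterMap (φ : N.conflictReplicatingRev.XTrans → Option (T × T))
    (G : Multiset N.conflictReplicatingRev.XTrans) (i : T) :
    ((G.filterMap φ).map Prod.fst).count i = (G.map fun y => ind (∃ j, φ y = some (i, j))).sum := by
  rw [Multiset.map_filterMap, Multiset.count_filterMap_eq_sum]
  simp

theorem count_snd_filterMap (φ : N.conflictReplicatingRev.XTrans → Option (T × T))
    (G : Multiset N.conflictReplicatingRev.XTrans) (j : T) :
    ((G.filterMap φ).map Prod.snd).count j = (G.map fun y => ind (∃ i, φ y = some (i, j))).sum := by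
  rw [Multiset.map_filterMap, Multiset.count_filterMap_eq_sum]
  simp

variable {M : N.conflictReplicatingRev.XPlace → ℕ}
  {G : Multiset N.conflictReplicatingRev.XTrans}

/-- The transitions are inspected one by one in this and the following balances; in `t·undo(f)` the
weight of the far arc has to be evaluated first, which is what `pre_undoF` does. -/
theorem base_balance (hB : N.conflictReplicating.Balanced M G) (p : S) :
    M (.base (.base p)) + dists p G = N.M0 p + ((fins G).map fun i => N.post i p).sum := by
  rw [fins, Multiset.sum_map_filterMap, dists]
  refine hB.of_forall (.base (.base p)) (fun y => ?_)
  induction y using xtrans_cases <;>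
    first | rw [pre_undoF] | skip
  all_goals
    simp [conflictReplicating, expand, xpre, xpost, lift, conflictReplicatingRev, cFlow, distOf,
      finOf]

/-- Each `distribute_p` puts a token on `p_c`. The tokens not there any more were consumed by a
`fetch^{p,c}_{i,j}`, or by an `initialise_c` that has not returned them. -/
theorem copy_balance (hB : N.conflictReplicating.Balanced M G) (p : S) (c : T)
    (hc : 0 < N.pre c p) :
    M (.base (.copy p c hc)) + (N.pre c p * N.conflictReplicatingRev.fires (.initialise c) G +
        ((fetches p c G).map fun ij => N.pre ij.1 p).sum) =
      dists p G + N.pre c p * N.conflictReplicatingRev.undones (.initialise c) G := by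
  rw [fetches, Multiset.sum_map_filterMap, dists, fires, undones, ← Multiset.sum_map_mul_left,
    ← Multiset.sum_map_mul_left, ← Multiset.sum_map_add, ← Multiset.sum_map_add]
  refine (hB.of_forall (.base (.copy p c hc)) (fun y => ?_)).trans (Nat.zero_add _)
  induction y using xtrans_cases <;>
    first | rw [pre_undoF] | skip
  all_goals
    simp [conflictReplicating, expand, xpre, xpost, lift, conflictReplicatingRev, cFlow, distOf,
      fetchOf, fireOf, undoneOf]
  case distribute => exact ind_congr (by aesop)
  case fireInitialise j _ | undoneInitialise j _ =>
    by_cases hcj : c = j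
    · exact Or.inl (by rw [hcj])
    · exact Or.inr (ind_eq_zero hcj)
  case fetch q d i j _ _ _ _ =>
    by_cases hpc : p = q ∧ c = d
    · simp [hpc]
    · simp [hpc]

theorem exists_piConf_eq_iff {h j i : T} {hj : N.LeC h j} :
    (∃ l, ∃ hl : N.LeC i l, CPlace.piConf h j hj = .piConf i l hl) ↔ i = h := by
  constructor
  · rintro ⟨l, hl, e⟩
    cases e
    rfl
  · rintro rfl
    exact ⟨j, hj, rfl⟩

theorem piConf_balance (hB : N.conflictReplicating.Balanced M G) {h j : T} (hj : N.LtC h j) :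
    M (.base (.piConf h j (Or.inl hj))) +
        (N.conflictReplicatingRev.fires (.transfer h j hj) G +
          ((execs G).map Prod.snd).count h) =
      1 + (((fetcheds G).map Prod.snd).count h +
        (N.conflictReplicatingRev.resets (.transfer h j hj) G).card) := by
  rw [fetcheds, execs, count_snd_filterMap, count_snd_filterMap, fires, resets,
    Multiset.card_filterMap_eq_sum, ← Multiset.sum_map_add, ← Multiset.sum_map_add]
  refine hB.of_forall (.base (.piConf h j (Or.inl hj))) (fun y => ?_)
  induction y using xtrans_cases <;>
    first | rw [pre_undoF] | skip
  all_goals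
    simp [conflictReplicating, expand, xpre, xpost, lift, conflictReplicatingRev, cFlow, fireOf,
      resetOf, execOf, fetchedOf]
  all_goals first
    | exact ind_congr exists_piConf_eq_iff
    | exact (ind_congr exists_piConf_eq_iff).symm
    | exact ind_congr (iff_of_eq (CPlace.piConf.injEq ..))
    | exact (ind_congr (iff_of_eq (CPlace.piConf.injEq ..))).symm

theorem piConf_self_balance (hB : N.conflictReplicating.Balanced M G) (j : T) :
    M (.base (.piConf j j (Or.inr rfl))) + ((execs G).map Prod.snd).count j =
      1 + ((fetcheds G).map Prod.snd).count j := by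
  rw [fetcheds, execs, count_snd_filterMap, count_snd_filterMap]
  refine hB.of_forall (.base (.piConf j j (Or.inr rfl))) (fun y => ?_)
  induction y using xtrans_cases <;>
    first | rw [pre_undoF] | skip
  all_goals
    simp [conflictReplicating, expand, xpre, xpost, lift, conflictReplicatingRev, cFlow, execOf,
      fetchedOf]
  case fireTransfer h l hl _ =>
    exact ind_eq_zero fun e => by cases e; exact lt_irrefl _ hl.1
  case resetTransfer i h l hl _ =>
    exact (ind_eq_zero fun e => by cases e; exact lt_irrefl _ hl.1).symm
  all_goals first
    | exact ind_congr exists_piConf_eq_iff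
    | exact (ind_congr exists_piConf_eq_iff).symm

/-- The loop of `execute^i_j` on `pre^i_j` does not affect the number of tokens. -/
theorem pre_balance (hB : N.conflictReplicating.Balanced M G) {i j : T} (hij : N.LeC i j) :
    M (.base (.pre i j hij)) +
        N.conflictReplicatingRev.undoFs (.pre i j hij) (.initialise i) G =
      N.conflictReplicatingRev.fires (.initialise i) G := by
  rw [fires, undoFs]
  refine (hB.of_forall (.base (.pre i j hij)) (fun y => ?_)).trans (Nat.zero_add _)
  induction y using xtrans_cases <;>
    first | rw [pre_undoF] | skip
  all_goals
    simp [conflictReplicating, expand, xpre, xpost, lift, conflictReplicatingRev, cFlow, fireOf,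
      undoFOf]
  all_goals exact ind_congr (by constructor <;> aesop)

theorem transIn_balance (hB : N.conflictReplicating.Balanced M G) {h j : T} (hj : N.LtC h j) :
    M (.base (.transIn h j hj)) +
        (N.conflictReplicatingRev.fires (.transfer h j hj) G +
          N.conflictReplicatingRev.undoFs (.transIn h j hj) (.initialise j) G) =
      N.conflictReplicatingRev.fires (.initialise j) G +
        N.conflictReplicatingRev.undones (.transfer h j hj) G := by
  rw [fires, fires, undoFs, undones, ← Multiset.sum_map_add, ← Multiset.sum_map_add]
  refine (hB.of_forall (.base (.transIn h j hj)) (fun y => ?_)).trans (Nat.zero_add _)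
  induction y using xtrans_cases <;>
    first | rw [pre_undoF] | skip
  all_goals
    simp [conflictReplicating, expand, xpre, xpost, lift, conflictReplicatingRev, cFlow, fireOf,
      undoFOf, undoneOf]
  all_goals exact ind_congr (by constructor <;> aesop)

theorem transOut_balance (hB : N.conflictReplicating.Balanced M G) {h j : T} (hj : N.LtC h j) :
    M (.base (.transOut h j hj)) +
        N.conflictReplicatingRev.undoFs (.transOut h j hj) (.transfer h j hj) G =
      N.conflictReplicatingRev.fires (.transfer h j hj) G := by
  rw [fires, undoFs]
  refine (hB.of_forall (.base (.transOut h j hj)) (fun y => ?_)).trans (Nat.zero_add _)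
  induction y using xtrans_cases <;>
    first | rw [pre_undoF] | skip
  all_goals
    simp [conflictReplicating, expand, xpre, xpost, lift, conflictReplicatingRev, cFlow, fireOf,
      undoFOf]

theorem fetchIn_balance (hB : N.conflictReplicating.Balanced M G) {p : S} {c i j : T}
    (hij : N.LeC i j) (hp : 0 < N.pre i p) (hc : 0 < N.pre c p) :
    M (.base (.fetchIn p c i j hij hp hc)) + (fetches p c G).count (i, j) =
      (execs G).count (i, j) := by
  rw [fetches, execs, Multiset.count_filterMap_eq_sum, Multiset.count_filterMap_eq_sum]
  refine (hB.of_forall (.base (.fetchIn p c i j hij hp hc)) (fun y => ?_)).trans (Nat.zero_add _)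
  induction y using xtrans_cases <;>
    first | rw [pre_undoF] | skip
  all_goals
    simp [conflictReplicating, expand, xpre, xpost, lift, conflictReplicatingRev, cFlow, execOf,
      fetchOf]
  all_goals exact ind_congr (by constructor <;> aesop)

theorem fetchOut_balance (hB : N.conflictReplicating.Balanced M G) {p : S} {c i j : T}
    (hij : N.LeC i j) (hp : 0 < N.pre i p) (hc : 0 < N.pre c p) :
    M (.base (.fetchOut p c i j hij hp hc)) + (fetcheds G).count (i, j) =
      (fetches p c G).count (i, j) := by
  rw [fetches, fetcheds, Multiset.count_filterMap_eq_sum, Multiset.count_filterMap_eq_sum]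
  refine (hB.of_forall (.base (.fetchOut p c i j hij hp hc)) (fun y => ?_)).trans (Nat.zero_add _)
  induction y using xtrans_cases <;>
    first | rw [pre_undoF] | skip
  all_goals
    simp [conflictReplicating, expand, xpre, xpost, lift, conflictReplicatingRev, cFlow, fetchedOf,
      fetchOf]
  all_goals exact ind_congr (by constructor <;> aesop)

theorem undo_balance (hB : N.conflictReplicating.Balanced M G) {i : T} {t : N.CTrans}
    (ht : t ∈ N.undoSet i) :
    M (.base (.undo i t ht)) + ((N.conflictReplicatingRev.undos t G).count i +
      (N.conflictReplicatingRev.elides t G).count i) = ((execs G).map Prod.fst).count i := by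
  rw [execs, undos, elides, count_fst_filterMap, Multiset.count_filterMap_eq_sum,
    Multiset.count_filterMap_eq_sum, ← Multiset.sum_map_add]
  refine (hB.of_forall (.base (.undo i t ht)) (fun y => ?_)).trans (Nat.zero_add _)
  induction y using xtrans_cases <;>
    first | rw [pre_undoF] | skip
  all_goals
    simp [conflictReplicating, expand, xpre, xpost, lift, conflictReplicatingRev, cFlow, execOf,
      undoOf, elideOf]
  all_goals first
    | exact ind_congr ((iff_of_eq (CPlace.undo.injEq ..)).trans (by aesop))
    | exact (ind_congr ((iff_of_eq (CPlace.undo.injEq ..)).trans (by aesop))).symm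
    | exact ind_congr (by aesop)

theorem reset_balance (hB : N.conflictReplicating.Balanced M G) {i : T} {t : N.CTrans}
    (ht : t ∈ N.undoSet i) :
    M (.base (.reset i t ht)) + ((N.conflictReplicatingRev.resets t G).count i +
      (N.conflictReplicatingRev.elides t G).count i) = ((fetcheds G).map Prod.fst).count i := by
  rw [fetcheds, resets, elides, count_fst_filterMap, Multiset.count_filterMap_eq_sum,
    Multiset.count_filterMap_eq_sum, ← Multiset.sum_map_add]
  refine (hB.of_forall (.base (.reset i t ht)) (fun y => ?_)).trans (Nat.zero_add _)
  induction y using xtrans_cases <;>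
    first | rw [pre_undoF] | skip
  all_goals
    simp [conflictReplicating, expand, xpre, xpost, lift, conflictReplicatingRev, cFlow, fetchedOf,
      resetOf, elideOf]
  all_goals first
    | exact ind_congr ((iff_of_eq (CPlace.reset.injEq ..)).trans (by aesop))
    | exact (ind_congr ((iff_of_eq (CPlace.reset.injEq ..)).trans (by aesop))).symm
    | exact ind_congr (by aesop)

theorem ack_balance (hB : N.conflictReplicating.Balanced M G) {i : T} {t : N.CTrans}
    (ht : t ∈ N.undoSet i) :
    M (.base (.ack i t ht)) + (fins G).count i =
      (N.conflictReplicatingRev.resets t G).count i +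
        (N.conflictReplicatingRev.elides t G).count i := by
  rw [fins, resets, elides, Multiset.count_filterMap_eq_sum,
    Multiset.count_filterMap_eq_sum, Multiset.count_filterMap_eq_sum, ← Multiset.sum_map_add]
  refine (hB.of_forall (.base (.ack i t ht)) (fun y => ?_)).trans (Nat.zero_add _)
  induction y using xtrans_cases <;>
    first | rw [pre_undoF] | skip
  all_goals
    simp [conflictReplicating, expand, xpre, xpost, lift, conflictReplicatingRev, cFlow, finOf,
      resetOf, elideOf]
  all_goals first
    | exact (ind_congr ((iff_of_eq (CPlace.ack.injEq ..)).trans (by aesop))).symm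
    | exact ind_congr (by aesop)

end PetriNet

/-! ### Executions in progress and firings waiting to be finalised -/

namespace PetriNet

open ReversibleNet

section Clash

variable {Act S T : Type*} {N : PetriNet Act S T}

/-- The transitions `i` and `j` have a common preplace. -/
def Clash (N : PetriNet Act S T) (i j : T) : Prop := N.pre i ⊓ N.pre j ≠ 0

theorem Clash.symm {i j : T} (h : N.Clash i j) : N.Clash j i := by
  rwa [Clash, inf_comm]

theorem clash_self (hfin : N.Finitary) (i : T) : N.Clash i i := by
  rw [Clash, inf_idem]
  exact hfin.1 i

theorem ConflictEq.clash (hfin : N.Finitary) {i j : T} (h : N.ConflictEq i j) : N.Clash i j := by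
  rcases h with h | rfl
  · exact h.2
  · exact clash_self hfin i

/-- Without fully reachable pure M, clashing is transitive among the transitions that are
individually enabled at a reachable marking. -/
theorem Clash.trans (hM : ¬ N.HasFullyReachablePureM) {C : S → ℕ} (hC : N.Reachable C) {t u v : T}
    (ht : N.pre t ≤ C) (hu : N.pre u ≤ C) (hv : N.pre v ≤ C) (htu : N.Clash t u)
    (huv : N.Clash u v) : N.Clash t v := by
  intro htv
  exact hM ⟨t, u, v, htu, huv, htv, C, hC, sup_le (sup_le ht hu) hv⟩

end Clash

variable {Act S T : Type*} [LinearOrder T] {N : PetriNet Act S T}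

/-- The pairs `(i, j)` for which `execute^i_j` has occurred but `fetched^i_j` has not (yet). -/
def progress (G : Multiset N.conflictReplicatingRev.XTrans) : Multiset (T × T) :=
  execs G - fetcheds G

/-- The indices `i` for which some `fetched^i_j` has occurred but `finalise^i` has not (yet). -/
def waiting (G : Multiset N.conflictReplicatingRev.XTrans) : Multiset T :=
  (fetcheds G).map Prod.fst - fins G

/-- The tokens consumed by `initialise_c` have not been returned. -/
def Initialised (c : T) (G : Multiset N.conflictReplicatingRev.XTrans) : Prop :=
  N.conflictReplicatingRev.undones (.initialise c) G <
    N.conflictReplicatingRev.fires (.initialise c) G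

/-- The token consumed by `transfer^h_j` from the place `π_{h#j}` has not been returned. -/
def Transferred {h j : T} (hj : N.LtC h j) (G : Multiset N.conflictReplicatingRev.XTrans) : Prop :=
  (N.conflictReplicatingRev.resets (.transfer h j hj) G).card <
    N.conflictReplicatingRev.fires (.transfer h j hj) G

variable {M : N.conflictReplicatingRev.XPlace → ℕ}
  {G : Multiset N.conflictReplicatingRev.XTrans}

theorem leC_of_mem_fetcheds {i j : T} (h : (i, j) ∈ fetcheds G) : N.LeC i j := by
  obtain ⟨y, -, hy⟩ := (Multiset.mem_filterMap _ _).1 h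
  induction y using xtrans_cases <;> simp [fetchedOf] at hy
  obtain ⟨rfl, rfl⟩ := hy
  assumption

theorem leC_of_mem_execs {i j : T} (h : (i, j) ∈ execs G) : N.LeC i j := by
  obtain ⟨y, -, hy⟩ := (Multiset.mem_filterMap _ _).1 h
  induction y using xtrans_cases <;> simp [execOf] at hy
  obtain ⟨rfl, rfl⟩ := hy
  assumption

theorem leC_of_mem_progress {i j : T} (h : (i, j) ∈ progress G) : N.LeC i j :=
  leC_of_mem_execs (Multiset.mem_of_le tsub_le_self h)

theorem count_fetcheds_le (hB : N.conflictReplicating.Balanced M G) {p : S} {c i : T}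
    (hp : 0 < N.pre i p) (hc : 0 < N.pre c p) (j : T) :
    (fetcheds G).count (i, j) ≤ (fetches p c G).count (i, j) := by
  by_cases h : (i, j) ∈ fetcheds G
  · have := fetchOut_balance hB (leC_of_mem_fetcheds h) hp hc
    omega
  · simp [Multiset.count_eq_zero_of_notMem h]

/-- Transitions have preplaces, so `fetched^i_j` needs tokens from some `fetch^{p,i}_{i,j}`. -/
theorem execs_eq (hfin : N.Finitary) (hB : N.conflictReplicating.Balanced M G) :
    execs G = fetcheds G + progress G := by
  refine (add_tsub_cancel_of_le (Multiset.le_iff_count.2 ?_)).symm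
  rintro ⟨i, j⟩
  obtain ⟨p, hp⟩ : ∃ p, 0 < N.pre i p := by
    by_contra! h
    exact hfin.1 i (funext fun p => Nat.le_zero.1 (h p))
  by_cases h : (i, j) ∈ fetcheds G
  · have h1 := fetchOut_balance hB (leC_of_mem_fetcheds h) hp hp
    have h2 := fetchIn_balance hB (leC_of_mem_fetcheds h) hp hp
    omega
  · simp [Multiset.count_eq_zero_of_notMem h]

/-- The interface places of `initialise_i` show that `finalise^i` occurs at most as often as the
transitions `fetched^i_j`. -/
theorem map_fst_fetcheds_eq (hB : N.conflictReplicating.Balanced M G) :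
    (fetcheds G).map Prod.fst = fins G + waiting G := by
  refine (add_tsub_cancel_of_le (Multiset.le_iff_count.2 fun i => ?_)).symm
  have h := initialise_mem_undoSet_iff (N := N) (i := i).2 (Or.inr rfl)
  have h1 := ack_balance hB h
  have h2 := reset_balance hB h
  omega

/-- The token of `π_{h#j}` is either there, or held by `transfer^h_j`, or held by an execution in
progress at `h`. -/
theorem piConf_eq (hfin : N.Finitary) (hB : N.conflictReplicating.Balanced M G) {h j : T}
    (hj : N.LtC h j) :
    M (.base (.piConf h j (Or.inl hj))) +
        N.conflictReplicatingRev.fires (.transfer h j hj) G +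
          ((progress G).map Prod.snd).count h =
      1 + (N.conflictReplicatingRev.resets (.transfer h j hj) G).card := by
  have := piConf_balance hB hj
  rw [execs_eq hfin hB, Multiset.map_add, Multiset.count_add] at this
  omega

theorem piConf_self_eq (hfin : N.Finitary) (hB : N.conflictReplicating.Balanced M G) (j : T) :
    M (.base (.piConf j j (Or.inr rfl))) + ((progress G).map Prod.snd).count j = 1 := by
  have := piConf_self_balance hB j
  rw [execs_eq hfin hB, Multiset.map_add, Multiset.count_add] at this
  omega

theorem far_pre {j k : T} (hk : N.LeC j k) :
    0 < N.conflictReplicatingRev.F (.pre j k hk) (.initialise j) .far := by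
  exact ind_pos (Or.inl ⟨k, hk, rfl⟩)

theorem undones_initialise_le (hB : N.conflictReplicating.Balanced M G) {f : N.CPlace} {j : T}
    (hf : 0 < N.conflictReplicatingRev.F f (.initialise j) .far) :
    N.conflictReplicatingRev.undones (.initialise j) G ≤
      N.conflictReplicatingRev.undoFs f (.initialise j) G := by
  have := took_balance hB f (.initialise j) (reversible_initialise j) hf
  omega

theorem initialised_of_pre (hB : N.conflictReplicating.Balanced M G) {i j : T} {hij : N.LeC i j}
    (h : 0 < M (.base (.pre i j hij))) : Initialised i G := by
  have h1 := pre_balance hB hij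
  have h2 := undones_initialise_le hB (far_pre hij)
  unfold Initialised
  omega

theorem transOut_add_undones_le (hB : N.conflictReplicating.Balanced M G) {h j : T}
    (hj : N.LtC h j) :
    M (.base (.transOut h j hj)) + N.conflictReplicatingRev.undones (.transfer h j hj) G ≤
      N.conflictReplicatingRev.fires (.transfer h j hj) G := by
  have h1 := transOut_balance hB hj
  have h2 := took_balance hB (.transOut h j hj) (.transfer h j hj) (reversible_transfer hj)
    (by simp [conflictReplicatingRev, cFlow])
  omega

/-- While `trans^h_j-out` is marked, `transfer^h_j` holds the token of `trans^h_j-in`, which has to be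
returned before `initialise_j` can be undone. -/
theorem initialised_of_transOut (hB : N.conflictReplicating.Balanced M G) {h j : T}
    {hj : N.LtC h j} (hM : 0 < M (.base (.transOut h j hj))) : Initialised j G := by
  have h1 := transOut_add_undones_le hB hj
  have h2 := transIn_balance hB hj
  have h3 := undones_initialise_le hB (f := .transIn h j hj) (j := j)
    (by simp [conflictReplicatingRev, cFlow, hj])
  unfold Initialised
  omega

theorem transOut_add_resets_le (hB : N.conflictReplicating.Balanced M G) {h j : T}
    (hj : N.LtC h j) :
    M (.base (.transOut h j hj)) + (N.conflictReplicatingRev.resets (.transfer h j hj) G).card ≤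
      N.conflictReplicatingRev.fires (.transfer h j hj) G := by
  have h1 := transOut_add_undones_le hB hj
  have h2 := rho_balance hB (.transfer h j hj) (reversible_transfer hj)
  omega

/-! ### The simulated marking of the original net -/

/-- If every firing of `i` in the original net is accounted for at `finalise^i`, then the tokens
held by `initialise_c` and those consumed by all firings that still wait for their finalisation
are disjoint parts of the simulated marking: each of the latter consumed the copies `p_c`. -/
theorem pre_mul_add_sum_waiting_le (hB : N.conflictReplicating.Balanced M G) {C : S → ℕ}
    (hC : N.Balanced C (fins G)) {p : S} {c : T} (hc : 0 < N.pre c p) {H : ℕ}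
    (hH : N.conflictReplicatingRev.undones (.initialise c) G + H ≤
      N.conflictReplicatingRev.fires (.initialise c) G) :
    N.pre c p * H + ((waiting G).map fun i => N.pre i p).sum ≤ C p := by
  have h1 := base_balance hB p
  have h2 := copy_balance hB p c hc
  have h3 := hC p
  have h4 : ((fetcheds G).map fun ij => N.pre ij.1 p).sum ≤
      ((fetches p c G).map fun ij => N.pre ij.1 p).sum :=
    Multiset.sum_map_le_of_count_le fun ij hij => count_fetcheds_le hB hij hc ij.2
  have h5 : ((fetcheds G).map fun ij => N.pre ij.1 p).sum =
      ((fins G).map fun i => N.pre i p).sum + ((waiting G).map fun i => N.pre i p).sum := by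
    rw [← Multiset.sum_add, ← Multiset.map_add, ← map_fst_fetcheds_eq hB, Multiset.map_map]
    rfl
  have h6 := Nat.mul_le_mul_left (N.pre c p) hH
  rw [Nat.mul_add] at h6
  omega

theorem pre_le_sum_waiting {i : T} (hi : i ∈ waiting G) (p : S) :
    N.pre i p ≤ ((waiting G).map fun i => N.pre i p).sum :=
  Multiset.le_sum_of_mem (Multiset.mem_map_of_mem (fun i => N.pre i p) hi)

theorem pre_le_of_waiting (hB : N.conflictReplicating.Balanced M G) {C : S → ℕ}
    (hC : N.Balanced C (fins G)) {i : T} (hi : i ∈ waiting G) : N.pre i ≤ C := fun p => by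
  rcases Nat.eq_zero_or_pos (N.pre i p) with h | h
  · rw [h]; exact Nat.zero_le _
  · have h1 := pre_balance hB (i := i) (j := i) (Or.inr rfl)
    have h2 := undones_initialise_le hB (far_pre (Or.inr rfl : N.LeC i i))
    -- The copies `p_i` witness the bound; `initialise_i` need not hold any tokens.
    have h3 := pre_mul_add_sum_waiting_le hB hC h (H := 0) (by omega)
    have h4 := pre_le_sum_waiting hi p
    change N.pre i p ≤ C p
    omega

theorem pre_le_of_initialised (hB : N.conflictReplicating.Balanced M G) {C : S → ℕ}
    (hC : N.Balanced C (fins G)) {c : T} (hc : Initialised c G) : N.pre c ≤ C := fun p => by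
  rcases Nat.eq_zero_or_pos (N.pre c p) with h | h
  · rw [h]; exact Nat.zero_le _
  · have := pre_mul_add_sum_waiting_le hB hC h (H := 1) hc
    change N.pre c p ≤ C p
    omega

theorem LeC.clash (hfin : N.Finitary) {i j : T} (h : N.LeC i j) : N.Clash i j := by
  rcases h with h | rfl
  · exact h.2.2
  · exact clash_self hfin i

/-- While `i` waits for its finalisation, no transition that clashes with `i` is initialised: the
two would be concurrently enabled at the simulated marking. -/
theorem not_clash_of_waiting_of_initialised (hconf : N.StructuralConflict)
    (hB : N.conflictReplicating.Balanced M G) {C : S → ℕ} (hCr : N.Reachable C)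
    (hC : N.Balanced C (fins G)) {i c : T} (hi : i ∈ waiting G) (hc : Initialised c G) :
    ¬ N.Clash i c := by
  refine not_not_intro (hconf i c ⟨C, hCr, enabled_pair fun p => ?_⟩)
  rcases Nat.eq_zero_or_pos (N.pre c p) with h | h
  · simpa [h] using pre_le_of_waiting hB hC hi p
  · have h1 := pre_mul_add_sum_waiting_le hB hC h (H := 1) hc
    have h2 := pre_le_sum_waiting hi p
    simp only [Pi.add_apply]
    omega

end PetriNet

/-! ### Mutual exclusion inside a cluster of conflicts -/

namespace PetriNet

open ReversibleNet

variable {Act S T : Type*} [LinearOrder T] {N : PetriNet Act S T}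

/-- The simulation invariant for a marking `M` reached by firing `G`. -/
structure Invariant (M : N.conflictReplicatingRev.XPlace → ℕ)
    (G : Multiset N.conflictReplicatingRev.XTrans) : Prop where
  balanced : N.conflictReplicating.Balanced M G
  /-- The firings accounted for so far lead to a reachable marking of `N`, at which the transitions
  involved in an execution in progress are enabled. -/
  simulated : ∃ C, N.Reachable C ∧ N.Balanced C (fins G) ∧
    ∀ i j, (i, j) ∈ progress G → N.pre i ≤ C ∧ N.pre j ≤ C
  not_clash_waiting : ∀ i j, (i, j) ∈ progress G → ∀ k ∈ waiting G,
    ¬ N.Clash k i ∧ ¬ N.Clash k j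
  /-- An execution in progress at `j` blocks all `π_{h#j}`. -/
  transferred : ∀ i j, (i, j) ∈ progress G → ∀ h, ∀ hj : N.LtC h j, Transferred hj G

theorem ltC_or_ltC_of_clash {i j : T} (hij : i ≠ j) (h : N.Clash i j) : N.LtC i j ∨ N.LtC j i := by
  rcases lt_or_gt_of_ne hij with hlt | hlt
  · exact Or.inl ⟨hlt, hij, h⟩
  · exact Or.inr ⟨hlt, hij.symm, h.symm⟩

variable {M : N.conflictReplicatingRev.XPlace → ℕ}
  {G : Multiset N.conflictReplicatingRev.XTrans}

/-- The execution in progress holds the only token of `π_{h#j}`. -/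
theorem not_transferred_of_progress (hfin : N.Finitary) (hB : N.conflictReplicating.Balanced M G)
    {i h j : T} (hi : (i, h) ∈ progress G) (hj : N.LtC h j) : ¬ Transferred hj G := by
  have h1 := piConf_eq hfin hB hj
  have h2 : 0 < ((progress G).map Prod.snd).count h :=
    Multiset.count_pos.2 (Multiset.mem_map_of_mem Prod.snd hi)
  unfold Transferred
  omega

/-- Two executions in progress never take place at clashing locations. -/
theorem Invariant.not_clash_of_progress (hfin : N.Finitary) (hI : Invariant M G) {i j k m : T}
    {R : Multiset (T × T)} (hP : progress G = (i, j) ::ₘ R) (hk : (k, m) ∈ R) :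
    ¬ N.Clash j m := by
  intro hc
  have hi : (i, j) ∈ progress G := by simp [hP]
  have hk' : (k, m) ∈ progress G := by simp [hP, hk]
  by_cases hjm : j = m
  · subst hjm
    have h1 := piConf_self_eq hfin hI.balanced j
    have h2 : 0 < (R.map Prod.snd).count j :=
      Multiset.count_pos.2 (Multiset.mem_map_of_mem Prod.snd hk)
    rw [hP, Multiset.map_cons, Multiset.count_cons_self] at h1
    omega
  · rcases ltC_or_ltC_of_clash hjm hc with h | h
    · exact not_transferred_of_progress hfin hI.balanced hi h (hI.transferred _ _ hk' _ h)
    · exact not_transferred_of_progress hfin hI.balanced hk' h (hI.transferred _ _ hi _ h)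

section Execute

variable {i j : T} {hij : N.LeC i j}
  {hr : ¬ N.conflictReplicatingRev.Reversible (.execute i j hij)}

theorem pos_of_pre_le {t : N.conflictReplicatingRev.XTrans}
    (h : N.conflictReplicating.pre t ≤ M) {x : N.conflictReplicatingRev.XPlace}
    (hx : 0 < N.conflictReplicating.pre t x) : 0 < M x :=
  hx.trans_le (h x)

theorem execute_pre_pos :
    0 < N.conflictReplicating.pre (.standard (.execute i j hij) hr) (.base (.pre i j hij)) :=
  ind_pos (Or.inl rfl)

theorem execute_transOut_pos {h : T} (hj : N.LtC h j) :
    0 < N.conflictReplicating.pre (.standard (.execute i j hij) hr) (.base (.transOut h j hj)) :=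
  ind_pos (Or.inr (Or.inl ⟨h, hj, rfl⟩))

theorem execute_piConf_pos {l : T} (hl : N.LeC j l) :
    0 < N.conflictReplicating.pre (.standard (.execute i j hij) hr) (.base (.piConf j l hl)) :=
  ind_pos (Or.inr (Or.inr ⟨l, hl, rfl⟩))

theorem initialised_left_of_execute
    (hB : N.conflictReplicating.Balanced M G)
    (hen : N.conflictReplicating.pre (.standard (.execute i j hij) hr) ≤ M) :
    Initialised i G :=
  initialised_of_pre hB (pos_of_pre_le hen execute_pre_pos)

/-- If `i = j` this is witnessed by `pre^i_j`, and otherwise by `trans^i_j-out`. -/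
theorem initialised_right_of_execute
    (hB : N.conflictReplicating.Balanced M G)
    (hen : N.conflictReplicating.pre (.standard (.execute i j hij) hr) ≤ M) :
    Initialised j G := by
  rcases hij with h | rfl
  · exact initialised_of_transOut hB (pos_of_pre_le hen (execute_transOut_pos h))
  · exact initialised_left_of_execute hB hen

theorem transferred_of_execute
    (hB : N.conflictReplicating.Balanced M G)
    (hen : N.conflictReplicating.pre (.standard (.execute i j hij) hr) ≤ M)
    {h : T} (hj : N.LtC h j) : Transferred hj G := by
  have h1 := transOut_add_resets_le hB hj
  have h2 := pos_of_pre_le hen (execute_transOut_pos hj)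
  unfold Transferred
  omega

/-- No execution is in progress at a location that clashes with that of an enabled execution. -/
theorem Invariant.not_clash_of_execute (hfin : N.Finitary) (hI : Invariant M G)
    (hen : N.conflictReplicating.pre (.standard (.execute i j hij) hr) ≤ M) {k m : T}
    (hk : (k, m) ∈ progress G) : ¬ N.Clash j m := by
  intro hc
  by_cases hjm : j = m
  · subst hjm
    have h1 := piConf_self_eq hfin hI.balanced j
    have h2 : 0 < ((progress G).map Prod.snd).count j :=
      Multiset.count_pos.2 (Multiset.mem_map_of_mem Prod.snd hk)
    have h3 := pos_of_pre_le hen (execute_piConf_pos (Or.inr rfl))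
    omega
  · rcases ltC_or_ltC_of_clash hjm hc with h | h
    · have h1 := piConf_eq hfin hI.balanced h
      have h2 := pos_of_pre_le hen (execute_piConf_pos (Or.inl h))
      have h3 : Transferred h G := hI.transferred _ _ hk _ h
      unfold Transferred at h3
      omega
    · exact not_transferred_of_progress hfin hI.balanced hk h
        (transferred_of_execute hI.balanced hen h)

/-- No `initialise_g` with `g` clashing with `j` is being undone while some `execute^i_j` is
enabled: the undoing was caused by an execution of some `k` that clashes with `g`, and this is
either in progress, at a location clashing with `j`, or waiting for its finalisation, during which
`g` is not initialised. -/
theorem Invariant.not_take_of_execute (hfin : N.Finitary) (hconf : N.StructuralConflict)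
    (hM : ¬ N.HasFullyReachablePureM) (hI : Invariant M G)
    (hen : N.conflictReplicating.pre (.standard (.execute i j hij) hr) ≤ M) {g : T}
    (hgj : N.Clash g j) {f : N.CPlace} {ht : N.conflictReplicatingRev.Reversible (.initialise g)}
    {hf : 0 < N.conflictReplicatingRev.F f (.initialise g) .far} :
    ¬ 0 < M (.take f (.initialise g) ht hf) := by
  intro htake
  have hB := hI.balanced
  obtain ⟨C, hCr, hC, hCp⟩ := hI.simulated
  obtain ⟨⟨k, hk, hlt⟩, hg⟩ := exists_interface_of_take hB htake
  have hgk : N.Clash g k := (initialise_mem_undoSet_iff.1 hk).clash hfin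
  have h1 := undo_balance hB hk
  have h2 := ack_balance hB hk
  rw [execs_eq hfin hB, Multiset.map_add, map_fst_fetcheds_eq hB, Multiset.count_add,
    Multiset.count_add] at h1
  have h3 : 0 < (waiting G).count k ∨ 0 < ((progress G).map Prod.fst).count k := by omega
  rcases h3 with h3 | h3
  · exact not_clash_of_waiting_of_initialised hconf hB hCr hC (Multiset.count_pos.1 h3) hg
      hgk.symm
  · obtain ⟨⟨k', m⟩, hkm, rfl⟩ := Multiset.mem_map.1 (Multiset.count_pos.1 h3)
    obtain ⟨hk', hm⟩ := hCp _ _ hkm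
    have hgC := pre_le_of_initialised hB hC hg
    have hjC := pre_le_of_initialised hB hC (initialised_right_of_execute hB hen)
    exact hI.not_clash_of_execute hfin hen hkm
      (((hgj.symm.trans hM hCr hjC hgC hk' hgk).trans hM hCr hjC hk' hm
        ((leC_of_mem_progress hkm).clash hfin)))

end Execute

/-! ### Preservation of the simulation invariant -/

theorem invariant_zero : Invariant N.conflictReplicating.M0 0 := by
  have h : progress (0 : Multiset N.conflictReplicatingRev.XTrans) = 0 := rfl
  refine ⟨balanced_zero _, ⟨N.M0, .init, balanced_zero _, ?_⟩, ?_, ?_⟩ <;> simp [h]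

theorem fires_cons (u : N.CTrans) (t : N.conflictReplicatingRev.XTrans) :
    N.conflictReplicatingRev.fires u (t ::ₘ G) =
      N.conflictReplicatingRev.fireOf u t + N.conflictReplicatingRev.fires u G := by
  simp [fires]

theorem Transferred.cons {h j : T} {hj : N.LtC h j} (hG : Transferred hj G)
    {t : N.conflictReplicatingRev.XTrans}
    (ht : N.conflictReplicatingRev.resetOf (.transfer h j hj) t = none) :
    Transferred hj (t ::ₘ G) := by
  unfold Transferred at hG ⊢
  rw [fires_cons, resets, Multiset.filterMap_cons_none _ _ ht]
  exact hG.trans_le (Nat.le_add_left _ _)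

/-- The transitions other than `execute`, `fetched` and `finalise` preserve the invariant, provided
that they do not reset a transfer to the location of an execution in progress. -/
theorem Invariant.cons_of_none (hI : Invariant M G) {t : N.conflictReplicatingRev.XTrans}
    (ht : N.conflictReplicating.pre t ≤ M) (h1 : execOf t = none) (h2 : fetchedOf t = none)
    (h3 : finOf t = none)
    (h4 : ∀ i j, (i, j) ∈ progress G → ∀ h, ∀ hj : N.LtC h j,
      N.conflictReplicatingRev.resetOf (.transfer h j hj) t = none) :
    Invariant (M - N.conflictReplicating.pre t + N.conflictReplicating.post t) (t ::ₘ G) := by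
  have e1 : execs (t ::ₘ G) = execs G := Multiset.filterMap_cons_none _ _ h1
  have e2 : fetcheds (t ::ₘ G) = fetcheds G := Multiset.filterMap_cons_none _ _ h2
  have e3 : fins (t ::ₘ G) = fins G := Multiset.filterMap_cons_none _ _ h3
  have e4 : progress (t ::ₘ G) = progress G := by rw [progress, progress, e1, e2]
  have e5 : waiting (t ::ₘ G) = waiting G := by rw [waiting, waiting, e2, e3]
  refine ⟨hI.balanced.cons ht, ?_, ?_, ?_⟩
  · rw [e3, e4]
    exact hI.simulated
  · rw [e4, e5]
    exact hI.not_clash_waiting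
  · rw [e4]
    exact fun i j hij h hj => (hI.transferred i j hij h hj).cons (h4 i j hij h hj)

/-- A reset of `transfer^h_j` through the interface `i` shows that `i` waits for its
finalisation, so that no execution is in progress at `j`. -/
theorem Invariant.resetOf_eq_none (hfin : N.Finitary) (hI : Invariant M G) {i : T} {u : N.CTrans}
    {hu : N.conflictReplicatingRev.ui i u}
    (ht : N.conflictReplicating.pre (.reset i u hu) ≤ M) {k j : T} (hk : (k, j) ∈ progress G)
    {h : T} (hj : N.LtC h j) :
    N.conflictReplicatingRev.resetOf (.transfer h j hj) (.reset i u hu) = none := by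
  by_cases hne : CTrans.transfer h j hj = u
  · subst hne
    have h1 : 0 < M (.base (.reset i _ hu)) :=
      pos_of_pre_le ht (x := .base (.reset i _ hu))
        (Nat.add_pos_left (Nat.add_pos_left (ind_pos rfl) _) _)
    have h2 := reset_balance hI.balanced (i := i) hu
    have h3 := ack_balance hI.balanced (i := i) hu
    rw [map_fst_fetcheds_eq hI.balanced, Multiset.count_add] at h2
    have h4 : i ∈ waiting G := Multiset.count_pos.1 (by omega)
    exact absurd ((transfer_mem_undoSet_iff.1 hu).clash hfin).symm
      (hI.not_clash_waiting _ _ hk _ h4).2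
  · simp [resetOf, hne]

/-- The new execution `(i, j)` in progress inherits its properties from `i` and `j` being initialised
and from the marked places `trans^h_j-out`. -/
theorem Invariant.cons_execute (hfin : N.Finitary) (hconf : N.StructuralConflict)
    (hI : Invariant M G) {i j : T} {hij : N.LeC i j}
    {hr : ¬ N.conflictReplicatingRev.Reversible (.execute i j hij)}
    (ht : N.conflictReplicating.pre (.standard (.execute i j hij) hr) ≤ M) :
    Invariant (M - N.conflictReplicating.pre (.standard (.execute i j hij) hr) +
      N.conflictReplicating.post (.standard (.execute i j hij) hr))
      (.standard (.execute i j hij) hr ::ₘ G) := by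
  have hB := hI.balanced
  have hB' := hB.cons ht
  obtain ⟨C, hCr, hC, hCp⟩ := hI.simulated
  set t : N.conflictReplicatingRev.XTrans := .standard (.execute i j hij) hr
  have e1 : execs (t ::ₘ G) = (i, j) ::ₘ execs G := Multiset.filterMap_cons_some _ _ _ rfl
  have e2 : fetcheds (t ::ₘ G) = fetcheds G := Multiset.filterMap_cons_none _ _ rfl
  have e3 : fins (t ::ₘ G) = fins G := Multiset.filterMap_cons_none _ _ rfl
  have e4 : progress (t ::ₘ G) = (i, j) ::ₘ progress G := by
    have h := execs_eq hfin hB'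
    rw [e1, e2, execs_eq hfin hB, ← Multiset.add_cons] at h
    exact (add_left_cancel h).symm
  have e5 : waiting (t ::ₘ G) = waiting G := by rw [waiting, waiting, e2, e3]
  have hi := initialised_left_of_execute hB ht
  have hj := initialised_right_of_execute hB ht
  refine ⟨hB', ⟨C, hCr, by rwa [e3], ?_⟩, ?_, ?_⟩
  · intro a b hab
    rw [e4, Multiset.mem_cons, Prod.mk.injEq] at hab
    obtain ⟨rfl, rfl⟩ | hab := hab
    · exact ⟨pre_le_of_initialised hB hC hi, pre_le_of_initialised hB hC hj⟩
    · exact hCp _ _ hab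
  · intro a b hab k hk
    rw [e5] at hk
    rw [e4, Multiset.mem_cons, Prod.mk.injEq] at hab
    obtain ⟨rfl, rfl⟩ | hab := hab
    · exact ⟨not_clash_of_waiting_of_initialised hconf hB hCr hC hk hi,
        not_clash_of_waiting_of_initialised hconf hB hCr hC hk hj⟩
    · exact hI.not_clash_waiting _ _ hab _ hk
  · intro a b hab h hh
    rw [e4, Multiset.mem_cons, Prod.mk.injEq] at hab
    obtain ⟨rfl, rfl⟩ | hab := hab
    · exact (transferred_of_execute hB ht hh).cons rfl
    · exact (hI.transferred _ _ hab _ hh).cons rfl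

/-- Here `i` becomes waiting; it does not clash with the remaining executions in progress, because
only one execution is in progress in its cluster. -/
theorem Invariant.cons_fetched (hfin : N.Finitary) (hM : ¬ N.HasFullyReachablePureM)
    (hI : Invariant M G) {i j : T} {hij : N.LeC i j}
    {hr : ¬ N.conflictReplicatingRev.Reversible (.fetched i j hij)}
    (ht : N.conflictReplicating.pre (.standard (.fetched i j hij) hr) ≤ M) :
    Invariant (M - N.conflictReplicating.pre (.standard (.fetched i j hij) hr) +
      N.conflictReplicating.post (.standard (.fetched i j hij) hr))
      (.standard (.fetched i j hij) hr ::ₘ G) := by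
  have hB := hI.balanced
  have hB' := hB.cons ht
  obtain ⟨C, hCr, hC, hCp⟩ := hI.simulated
  set t : N.conflictReplicatingRev.XTrans := .standard (.fetched i j hij) hr
  have e1 : execs (t ::ₘ G) = execs G := Multiset.filterMap_cons_none _ _ rfl
  have e2 : fetcheds (t ::ₘ G) = (i, j) ::ₘ fetcheds G := Multiset.filterMap_cons_some _ _ _ rfl
  have e3 : fins (t ::ₘ G) = fins G := Multiset.filterMap_cons_none _ _ rfl
  have e4 : progress G = (i, j) ::ₘ progress (t ::ₘ G) := by
    have h := execs_eq hfin hB'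
    rw [e1, e2, execs_eq hfin hB, Multiset.cons_add, ← Multiset.add_cons] at h
    exact add_left_cancel h
  have e5 : waiting (t ::ₘ G) = i ::ₘ waiting G := by
    have h := map_fst_fetcheds_eq hB'
    rw [e2, e3, Multiset.map_cons, map_fst_fetcheds_eq hB, ← Multiset.add_cons] at h
    exact (add_left_cancel h).symm
  have hmem : ∀ {a}, a ∈ progress (t ::ₘ G) → a ∈ progress G := fun h => by
    rw [e4]
    exact Multiset.mem_cons_of_mem h
  refine ⟨hB', ⟨C, hCr, by rwa [e3], fun a b hab => hCp _ _ (hmem hab)⟩, ?_,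
    fun a b hab h hh => (hI.transferred _ _ (hmem hab) _ hh).cons rfl⟩
  intro a b hab k hk
  rw [e5, Multiset.mem_cons] at hk
  obtain rfl | hk := hk
  · obtain ⟨hkC, hjC⟩ := hCp k j (by simp [e4])
    obtain ⟨haC, hbC⟩ := hCp a b (hmem hab)
    have hjb := hI.not_clash_of_progress hfin e4 hab
    have hb : ¬ N.Clash k b := fun h =>
      hjb ((hij.clash hfin).symm.trans hM hCr hjC hkC hbC h)
    exact ⟨fun h => hb (h.trans hM hCr hkC haC hbC
      ((leC_of_mem_progress hab).clash hfin)), hb⟩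
  · exact hI.not_clash_waiting _ _ (hmem hab) _ hk

/-- The simulated net fires `i`. This takes no tokens needed by executions in progress, as `i` was
waiting. -/
theorem Invariant.cons_finalise (hI : Invariant M G) {i : T}
    {hr : ¬ N.conflictReplicatingRev.Reversible (.finalise i)}
    (ht : N.conflictReplicating.pre (.standard (.finalise i) hr) ≤ M) :
    Invariant (M - N.conflictReplicating.pre (.standard (.finalise i) hr) +
      N.conflictReplicating.post (.standard (.finalise i) hr))
      (.standard (.finalise i) hr ::ₘ G) := by
  have hB := hI.balanced
  have hB' := hB.cons ht
  obtain ⟨C, hCr, hC, hCp⟩ := hI.simulated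
  set t : N.conflictReplicatingRev.XTrans := .standard (.finalise i) hr
  have e1 : execs (t ::ₘ G) = execs G := Multiset.filterMap_cons_none _ _ rfl
  have e2 : fetcheds (t ::ₘ G) = fetcheds G := Multiset.filterMap_cons_none _ _ rfl
  have e3 : fins (t ::ₘ G) = i ::ₘ fins G := Multiset.filterMap_cons_some _ _ _ rfl
  have e4 : progress (t ::ₘ G) = progress G := by rw [progress, progress, e1, e2]
  have e5 : waiting G = i ::ₘ waiting (t ::ₘ G) := by
    have h := map_fst_fetcheds_eq hB'
    rw [e2, e3, map_fst_fetcheds_eq hB, Multiset.cons_add, ← Multiset.add_cons] at h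
    exact add_left_cancel h
  have hi : i ∈ waiting G := by simp [e5]
  have hiC := pre_le_of_waiting hB hC hi
  have hpres : ∀ k, N.pre k ≤ C → ¬ N.Clash i k → N.pre k ≤ C - N.pre i + N.post i := by
    intro k hk hik p
    have h1 : min (N.pre i p) (N.pre k p) = 0 := congrFun (not_not.1 hik) p
    have h2 : N.pre k p ≤ C p := hk p
    simp only [Pi.add_apply, Pi.sub_apply]
    omega
  refine ⟨hB', ⟨C - N.pre i + N.post i, .step hCr (G := {i}) ⟨by simp, by simpa using hiC, by simp⟩,
    by rw [e3]; exact hC.cons hiC, ?_⟩, ?_, ?_⟩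
  · intro a b hab
    rw [e4] at hab
    obtain ⟨ha, hb⟩ := hI.not_clash_waiting _ _ hab _ hi
    exact ⟨hpres _ (hCp _ _ hab).1 ha, hpres _ (hCp _ _ hab).2 hb⟩
  · intro a b hab k hk
    rw [e4] at hab
    exact hI.not_clash_waiting _ _ hab _ (by rw [e5]; exact Multiset.mem_cons_of_mem hk)
  · intro a b hab h hh
    rw [e4] at hab
    exact (hI.transferred _ _ hab _ hh).cons rfl

theorem Invariant.cons (hfin : N.Finitary) (hconf : N.StructuralConflict)
    (hM : ¬ N.HasFullyReachablePureM) (hI : Invariant M G) {t : N.conflictReplicatingRev.XTrans}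
    (ht : N.conflictReplicating.pre t ≤ M) :
    Invariant (M - N.conflictReplicating.pre t + N.conflictReplicating.post t) (t ::ₘ G) := by
  induction t using xtrans_cases with
  | execute => exact hI.cons_execute hfin hconf ht
  | fetched => exact hI.cons_fetched hfin hM ht
  | finalise => exact hI.cons_finalise ht
  | resetInitialise =>
    exact hI.cons_of_none ht rfl rfl rfl fun _ _ hk _ hj => hI.resetOf_eq_none hfin ht hk hj
  | resetTransfer =>
    exact hI.cons_of_none ht rfl rfl rfl fun _ _ hk _ hj => hI.resetOf_eq_none hfin ht hk hj
  | _ => exact hI.cons_of_none ht rfl rfl rfl fun _ _ _ _ _ => rfl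

/-! ### The distribution -/

/-- The location of a place of the untranslated net; places that are not near any `execute^i_j`
share the location `none`. -/
def placeLoc : N.CPlace → Option T
  | .piConf h _ _ => some h
  | .pre _ j _ => some j
  | .transIn h _ _ => some h
  | .transOut _ j _ => some j
  | _ => none

/-- The location of a place of the expansion. -/
def xplaceLoc : N.conflictReplicatingRev.XPlace → Option T
  | .base s => placeLoc s
  | .take f _ _ _ => placeLoc f
  | _ => none

/-- The location of a transition of the expansion. -/
def xtransLoc : N.conflictReplicatingRev.XTrans → Option T
  | .standard (.execute _ j _) _ => some j
  | .fire (.transfer h _ _) _ => some h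
  | .undoF f _ _ _ => placeLoc f
  | _ => none

theorem xtransLoc_eq_of_pre_pos {s : N.conflictReplicatingRev.XPlace}
    {t : N.conflictReplicatingRev.XTrans} (h : 0 < N.conflictReplicating.pre t s) :
    xtransLoc t = xplaceLoc s := by
  induction t using xtrans_cases <;>
    first | rw [pre_undoF] at h | skip
  all_goals
    try simp only [conflictReplicating, expand, xpre, lift_pos_iff] at h
  all_goals
    simp only [conflictReplicatingRev, cFlow, Nat.add_pos_iff_pos_or_pos, ind_pos_iff,
      Nat.zero_add, CanonicallyOrderedAdd.mul_pos] at h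
  all_goals aesop

/-- A visible transition `execute^i_j` shares a place holding at most one token with every other
transition located at `j`, except for the undoing of parts of `initialise_g`, which never takes
place while `execute^i_j` is enabled. -/
theorem xtransLoc_ne_of_concurrent (hfin : N.Finitary) (hconf : N.StructuralConflict)
    (hM : ¬ N.HasFullyReachablePureM) {t u : N.conflictReplicatingRev.XTrans}
    (htu : N.conflictReplicating.Concurrent t u) (ht : N.conflictReplicating.label t ≠ none) :
    xtransLoc t ≠ xtransLoc u := by
  intro hloc
  obtain ⟨M, hMr, hpair⟩ := htu
  obtain ⟨G, hI⟩ := hMr.exists_history (P := Invariant) invariant_zero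
    fun _ _ _ hI ht => hI.cons hfin hconf hM ht
  have hle := hpair.pre_add_pre_le
  clear hpair
  have hB := hI.balanced
  induction t using xtrans_cases with
  | execute i j hij hr =>
    have hen : N.conflictReplicating.pre (.standard (.execute i j hij) hr) ≤ M :=
      fun x => (Nat.le_add_right _ _).trans (hle x)
    have hen' : N.conflictReplicating.pre u ≤ M := fun x => (Nat.le_add_left _ _).trans (hle x)
    have hshare : ∀ x, 0 < N.conflictReplicating.pre (.standard (.execute i j hij) hr) x →
        0 < N.conflictReplicating.pre u x → 2 ≤ M x := fun x h1 h2 => by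
      have h3 := hle x
      simp only [Pi.add_apply] at h3
      omega
    induction u using xtrans_cases with
    | execute k m hkm hr' =>
      obtain rfl : j = m := Option.some.inj hloc
      have h1 := hshare _ (execute_piConf_pos (Or.inr rfl)) (execute_piConf_pos (Or.inr rfl))
      have h2 := piConf_self_eq hfin hB j
      omega
    | fireTransfer h l hl hr' =>
      obtain rfl : j = h := Option.some.inj hloc
      have h1 := hshare (.base (.piConf j l (Or.inl hl))) (execute_piConf_pos (Or.inl hl))
        (by simp [conflictReplicating, expand, xpre, lift, conflictReplicatingRev, cFlow])
      have h2 := piConf_eq hfin hB hl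
      have h3 := transOut_add_resets_le hB hl
      omega
    | undoFPre g m hm hr' hf =>
      obtain rfl : j = m := Option.some.inj hloc
      refine hI.not_take_of_execute hfin hconf hM hen (hm.clash hfin) (pos_of_pre_le hen' ?_)
        (f := .pre g j hm) (ht := hr') (hf := hf)
      rw [pre_undoF]
      simp
    | undoFTransIn h g hg hr' hf =>
      obtain rfl : j = h := Option.some.inj hloc
      refine hI.not_take_of_execute hfin hconf hM hen (Clash.symm (i := j) hg.2.2)
        (pos_of_pre_le hen' ?_)
        (f := .transIn j g hg) (ht := hr') (hf := hf)
      rw [pre_undoF]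
      simp
    | undoFTransOut h m hm hr' hf =>
      obtain rfl : j = m := Option.some.inj hloc
      have h1 := hshare (.base (.transOut h j hm)) (execute_transOut_pos hm)
        (by rw [pre_undoF]; simp)
      have h2 := transOut_add_resets_le hB hm
      have h3 := piConf_eq hfin hB hm
      omega
    | _ => exact Option.some_ne_none _ hloc
  | _ => exact ht rfl

end PetriNet

theorem mainTheorem4 {Act S T : Type*} [LinearOrder T] [WellFoundedLT T]
    (N : PetriNet Act S T) (hfin : N.Finitary) (hplain : N.Plain)
    (hconf : N.StructuralConflict) (hM : ¬ N.HasFullyReachablePureM) :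
    N.conflictReplicating.EssentiallyDistributed :=
  ⟨Setoid.ker (Sum.elim PetriNet.xplaceLoc PetriNet.xtransLoc),
    fun _ _ h => PetriNet.xtransLoc_eq_of_pre_pos h,
    fun _ _ h => PetriNet.xtransLoc_ne_of_concurrent hfin hconf hM h.1 h.2⟩
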